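/- Let $K\ge 1$, let $\triangle^K=\{s\in\mathbb R^K: s_k\ge 0,\ \sum_k s_k=1\}$ be the $(K-1)$-dimensional probability simplex with its Lebesgue measure, and let $\operatorname{int}\triangle^K=\{s\in\triangle^K: s_k>0 \text{ for all } k\}$. For a bandwidth $h>0$ let $$k_h(s;t)=\frac{\Gamma\bigl(\sum_{k=1}^K\alpha_k\bigr)}{\prod_{k=1}^K\Gamma(\alpha_k)}\prod_{k=1}^K s_k^{\alpha_k-1},\qquad \alpha_k=\frac{t_k}{h}+1,$$ be the Dirichlet kernel. Let $(x,y)$ be a random pair, where $y$ takes one of $K$ class values $1,\dots,K$, encoded as vectors $c_1,\dots,c_K\in\mathbb R^m$ (for example one-hot), let $f$ be a measurable map into $\triangle^K$, and let $(x_1,y_1),(x_2,y_2),\dots$ be i.i.d. copies of $(x,y)$. Assume that $f(x)$ has a density $p_{f(x)}$ with respect to Lebesgue measure on $\triangle^K$ that is Lipschitz continuous on $\operatorname{int}\triangle^K$, and let $p_{f(x),y}$ be a joint density of $(f(x),y)$ with respect to the product of Lebesgue and counting measure. Put $$r(s)=\frac{\sum_{k=1}^K c_k\,p_{f(x),y}(s,k)}{p_{f(x)}(s)}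 .$$ Then $\mathbb E[c_y\mid f(x)]=r(f(x))$ almost surely. Moreover, the kernel ratio with the Dirichlet kernel is a pointwise consistent estimator of this conditional expectation: call a sequence $h_n>0$ admissible if $h_n\to0$ and $n\,h_n^{(K-1)/2}\to\infty$. Admissible sequences exist, and $$\underset{n\to\infty}{\operatorname{plim}}\ \frac{\sum_{i=1}^n k_{h_n}(s;f(x_i))\,c_{y_i}}{\sum_{i=1}^n k_{h_n}(s;f(x_i))}=r(s)$$ for every admissible sequence $(h_n)$, both (a) for almost every $s$ with respect to the law of $f(x)$ (the exceptional null set not depending on $(h_n)$), and (b) for every $s\in\operatorname{int}\triangle^K$ with $p_{f(x)}(s)>0$ at which all the functions $p_{f(x),y}(\cdot,k)$, $k=1,\dots,K$, are continuous. -/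

import Mathlib

open MeasureTheory ProbabilityTheory Filter Topology

/-- The probability simplex of dimension `d`, with `d + 1` vertices (classes). -/
abbrev Simplex (d : ℕ) : Type := stdSimplex ℝ (Fin (d + 1))

/-- The relative interior of the simplex: all coordinates are positive. -/
def simplexInterior (d : ℕ) : Set (Simplex d) := {s | ∀ k, 0 < s.1 k}

/-- The coordinate chart of the simplex that drops the last coordinate. -/
def simplexChart (d : ℕ) (s : Simplex d) : Fin d → ℝ := fun i => s.1 i.castSucc

/-- The chart is injective, so that pulling a measure back along it is meaningful. -/
theorem simplexChart_injective (d : ℕ) : Function.Injective (simplexChart d) := by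
  intro s t hst
  have hc : ∀ i : Fin d, s.1 i.castSucc = t.1 i.castSucc := fun i => congrFun hst i
  have hs := s.2.2
  have ht := t.2.2
  rw [Fin.sum_univ_castSucc] at hs ht
  apply Subtype.ext
  funext k
  refine Fin.lastCases ?_ hc k
  have : ∑ i : Fin d, s.1 i.castSucc = ∑ i : Fin d, t.1 i.castSucc :=
    Finset.sum_congr rfl fun i _ => hc i
  linarith

/-- The chart is a measurable embedding of the simplex into `ℝ^d`. -/
theorem simplexChart_measurableEmbedding (d : ℕ) : MeasurableEmbedding (simplexChart d) := by
  have hcont : Continuous (simplexChart d) :=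
    continuous_pi fun i => (continuous_apply i.castSucc).comp continuous_subtype_val
  have : CompactSpace (Simplex d) := isCompact_iff_compactSpace.mp (isCompact_stdSimplex ℝ _)
  exact (hcont.isClosedEmbedding (simplexChart_injective d)).measurableEmbedding

/-- The `d`-dimensional Lebesgue measure on the simplex, in the chart that drops the last
coordinate. -/
noncomputable def simplexVolume (d : ℕ) : Measure (Simplex d) :=
  Measure.comap (simplexChart d) volume

/-- The Dirichlet kernel `k(s; t)` with bandwidth `h`: the density at `s` of the Dirichlet
distribution with parameters `α = t / h + 1`. -/
noncomputable def dirichletKernel {d : ℕ} (h : ℝ) (s t : Simplex d) : ℝ :=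
  Real.Gamma (∑ k, (t.1 k / h + 1)) / (∏ k, Real.Gamma (t.1 k / h + 1)) *
    ∏ k, s.1 k ^ ((t.1 k / h + 1) - 1)

/-- The kernel ratio at `s` based on the first `n` scores `t i` and (encoded) labels `v i`. -/
noncomputable def kernelRatio {d : ℕ} {E : Type*} [AddCommGroup E] [Module ℝ E]
    (h : ℝ) (n : ℕ) (t : ℕ → Simplex d) (v : ℕ → E) (s : Simplex d) : E :=
  (∑ i ∈ Finset.range n, dirichletKernel h s (t i))⁻¹ •
    ∑ i ∈ Finset.range n, dirichletKernel h s (t i) • v i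

/-- `∑ₖ cₖ q(s, k) / p(s)`: the conditional mean of the label encoding `c` given the score `s`,
in terms of the joint density `q` of (score, label) and the density `p` of the score. -/
noncomputable def conditionalMean {d : ℕ} {E : Type*} [AddCommGroup E] [Module ℝ E]
    (c : Fin (d + 1) → E) (p : Simplex d → ℝ) (q : Simplex d → Fin (d + 1) → ℝ)
    (s : Simplex d) : E :=
  (p s)⁻¹ • ∑ k, q s k • c k

/-- Bandwidth sequences for `d`-dimensional Dirichlet kernels: `hₙ > 0`, `hₙ → 0` and
`n hₙ^(d/2) → ∞`. -/
structure IsBandwidth (d : ℕ) (h : ℕ → ℝ) : Prop where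
  pos : ∀ n, 0 < h n
  tendsto_zero : Tendsto h atTop (𝓝 0)
  tendsto_mass : Tendsto (fun n : ℕ => (n : ℝ) * h n ^ ((d : ℝ) / 2)) atTop atTop

/-! Write `d = K - 1` and let `I_h` be the integral of `k_h(s; t)` over `t`, which need not be one.
Dividing numerator and denominator by `n I_h` leaves the ratio unchanged, so it suffices to prove a
weak law for the averages of `k_h(s; f(x_i)) / I_h * w(y_i)`. The weight `w = 1` gives `p s`, the
indicator of class `k` gives `q s k`, and the quotient converges by continuity because `p s > 0`.

The means converge because the normalized kernel is an approximate identity of width `√h` in `t`.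
Its logarithm is linear in `t / h` minus terms `log Γ (t_k / h + 1)`. Comparing these with lines of
slope `log (s_k / h)` through `s_k / h` cancels the linear part, since the coordinates of `s` and
`t` have the same sum. Quadratic growth above these lines gives a Gaussian upper bound relative to
`k_h(s; s)` (`dirichletKernel_le`). A reverse bound within distance `√h`
(`exists_le_dirichletKernel`) shows that `I_h` is at least a constant times `k_h(s; s) h^(d/2)`. The
size of `k_h(s; s)` cancels, so no Stirling asymptotics are needed
(`exists_dirichletKernel_le_integral_mul`). Convergence follows at Lebesgue points of bounded
densities (`IsLebesguePoint.tendsto_dirichletKernel`).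

The variances vanish because the normalized kernel is at most `C h^(-d/2)`: the variance of the
average is then at most `C / (n h^(d/2))` times a bounded mean, and Chebyshev applies.

The Lipschitz assumption makes `p` bounded almost everywhere and continuous in the interior; since
`p = ∑ q_k` almost everywhere, each `q_k` is bounded too. Lebesgue differentiation then gives (a),
and continuity gives (b). The conditional expectation formula is an integration against the joint
density. -/

/-! ### Estimates for log Γ around a point -/

/-- The logarithm of `Γ (x + 1)`. -/
noncomputable def logGammaSucc (x : ℝ) : ℝ := Real.log (Real.Gamma (x + 1))

theorem logGammaSucc_sub_one {x : ℝ} (hx : 0 < x) :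
    logGammaSucc x - logGammaSucc (x - 1) = Real.log x := by
  unfold logGammaSucc
  rw [sub_add_cancel, Real.Gamma_add_one hx.ne',
    Real.log_mul hx.ne' (Real.Gamma_pos_of_pos hx).ne']
  ring

theorem convexOn_logGammaSucc : ConvexOn ℝ (Set.Ioi (-1)) logGammaSucc := by
  have h := Real.convexOn_log_Gamma.translate_left (1 : ℝ)
  refine (h.subset (fun x hx => ?_) (convex_Ioi _)).congr fun x _ => ?_
  · simp only [Set.mem_Ioi, Set.mem_preimage] at *
    linarith
  · simp [logGammaSucc]

/-- By convexity, slopes to the right of `a` are at least the slope over `[a - 1, a]`, which the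
functional equation of Γ evaluates exactly as `log a`. -/
theorem mul_log_le_logGammaSucc_sub {a x : ℝ} (ha : 0 < a) (hax : a ≤ x) :
    (x - a) * Real.log a ≤ logGammaSucc x - logGammaSucc a := by
  rcases hax.eq_or_lt with rfl | hlt
  · simp
  have h := convexOn_logGammaSucc.slope_mono_adjacent (x := a - 1) (y := a) (z := x)
    (by simpa using ha) (by simp only [Set.mem_Ioi]; linarith) (by linarith) hlt
  rw [logGammaSucc_sub_one ha, sub_sub_cancel, div_one, le_div_iff₀ (by linarith)] at h
  linarith

/-- The companion bound: the slope up to `x` is at most that over `[x, x + 1]`, which is `log (x +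
1)`. The shift by one is the source of the lower-order terms below. -/
theorem logGammaSucc_sub_le_mul_log {a x : ℝ} (ha : 0 ≤ a) (hax : a ≤ x) :
    logGammaSucc x - logGammaSucc a ≤ (x - a) * Real.log (x + 1) := by
  rcases hax.eq_or_lt with rfl | hlt
  · simp
  have h := convexOn_logGammaSucc.slope_mono_adjacent (x := a) (y := x) (z := x + 1)
    (by simp only [Set.mem_Ioi]; linarith) (by simp only [Set.mem_Ioi]; linarith) hlt
    (by linarith)
  have h1 := logGammaSucc_sub_one (x := x + 1) (by linarith)
  rw [add_sub_cancel_right] at h1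
  rw [h1, add_sub_cancel_left, div_one, div_le_iff₀ (by linarith)] at h
  linarith

theorem log_le_log_add {a u : ℝ} (ha : 0 < a) (hu : 0 < u) :
    Real.log u ≤ Real.log a + (u - a) / a := by
  have h := Real.log_le_sub_one_of_pos (div_pos hu ha)
  rw [Real.log_div hu.ne' ha.ne'] at h
  have : (u - a) / a = u / a - 1 := by field_simp
  linarith

/-- Quadratic growth of `log Γ (x + 1)` away from its tangent. -/
theorem logGammaSucc_sub_ge {a x N : ℝ} (ha : 0 < a) (haN : a ≤ N) (hx : 0 ≤ x) (hxN : x ≤ N) :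
    (x - a) * Real.log a + (x - a) ^ 2 / (4 * N) - 1 ≤ logGammaSucc x - logGammaSucc a := by
  have hN : 0 < N := ha.trans_le haN
  -- Convexity alone yields only the linear term. Cutting at the midpoint and using a separate slope
  -- on each half produces the quadratic gain.
  set m := (a + x) / 2 with hm
  have hm0 : 0 < m := by positivity
  rcases le_total a x with hax | hax
  · have h1 := mul_log_le_logGammaSucc_sub hm0 (show m ≤ x by linarith)
    have h2 := mul_log_le_logGammaSucc_sub ha (show a ≤ m by linarith)
    have h3 := log_le_log_add hm0 ha
    have h4 : (x - a) / (2 * N) ≤ (m - a) / m := by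
      rw [div_le_div_iff₀ (by positivity) hm0]
      have : m - a = (x - a) / 2 := by rw [hm]; ring
      rw [this]
      nlinarith [mul_nonneg (sub_nonneg.2 hax) (show 0 ≤ N - m by linarith)]
    have h5 : (a - m) / m = - ((m - a) / m) := by rw [← neg_sub, neg_div]
    have h6 : (x - m) * (Real.log a + (x - a) / (2 * N)) ≤ (x - m) * Real.log m :=
      mul_le_mul_of_nonneg_left (by linarith) (by linarith)
    have h7 : (x - m) * ((x - a) / (2 * N)) = (x - a) ^ 2 / (4 * N) := by
      rw [hm]; field_simp; ring
    nlinarith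
  -- To the left of `a` the slopes are `log (a + 1)` and `log (m + 1)`. Their shifts by one cost `(a
  -- - x) / a ≤ 1` in total, which is the `- 1` in the bound.
  · have h1 := logGammaSucc_sub_le_mul_log hm0.le (show m ≤ a by linarith)
    have h2 := logGammaSucc_sub_le_mul_log hx (show x ≤ m by linarith)
    have h3 := log_le_log_add ha (show 0 < a + 1 by linarith)
    have h4 := log_le_log_add ha (show 0 < m + 1 by linarith)
    have h5 := mul_le_mul_of_nonneg_left h3 (show 0 ≤ a - m by linarith)
    have h6 := mul_le_mul_of_nonneg_left h4 (show 0 ≤ m - x by linarith)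
    have h7 : (x - a) ^ 2 / (4 * N) ≤ (x - a) ^ 2 / (4 * a) := by gcongr
    have h8 : (a - m) * ((a + 1 - a) / a) + (m - x) * ((m + 1 - a) / a)
        = (a - x) / a - (x - a) ^ 2 / (4 * a) := by
      rw [hm]; field_simp; ring
    have h9 : (a - x) / a ≤ 1 := by rw [div_le_one ha]; linarith
    nlinarith

/-- `log Γ (x + 1)` is at most quadratically far above its tangent. -/
theorem logGammaSucc_sub_le {a x : ℝ} (hx : 0 < x) (hxa : a ≤ 2 * x) (ha : 0 < a) :
    logGammaSucc x - logGammaSucc a ≤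
      (x - a) * Real.log a + (2 * (x - a) ^ 2 + |x - a|) / a := by
  rcases le_total a x with hax | hax
  · have h1 := logGammaSucc_sub_le_mul_log ha.le hax
    have h3 := log_le_log_add ha (show 0 < x + 1 by linarith)
    have h5 := mul_le_mul_of_nonneg_left h3 (show 0 ≤ x - a by linarith)
    rw [abs_of_nonneg (by linarith)]
    have h8 : (x - a) * ((x + 1 - a) / a) ≤ (2 * (x - a) ^ 2 + (x - a)) / a := by
      rw [← mul_div_assoc]
      gcongr
      nlinarith [sq_nonneg (x - a)]
    nlinarith
  -- Here the slope `log x` is compared with `log a` at cost `(a - x) / x`; the assumption `a ≤ 2 *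
  -- x` turns the denominator into `a`, which explains the factor 2.
  · have h1 := mul_log_le_logGammaSucc_sub hx hax
    have h3 := log_le_log_add hx ha
    have h5 := mul_le_mul_of_nonneg_left h3 (show 0 ≤ a - x by linarith)
    have h8 : (a - x) * ((a - x) / x) ≤ (2 * (x - a) ^ 2 + |x - a|) / a := by
      rw [← mul_div_assoc, div_le_div_iff₀ hx ha]
      nlinarith [abs_nonneg (x - a), sq_nonneg (x - a), mul_nonneg (abs_nonneg (x - a)) hx.le,
        mul_nonneg (sq_nonneg (x - a)) (show 0 ≤ 2 * x - a by linarith)]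
    nlinarith

/-! ### Coordinates on the simplex and Gaussian bounds for the kernel -/

theorem Simplex.nonneg {d : ℕ} (s : Simplex d) (k : Fin (d + 1)) : 0 ≤ s.1 k := s.2.1 k

theorem Simplex.sum_eq_one {d : ℕ} (s : Simplex d) : ∑ k, s.1 k = 1 := s.2.2

theorem Simplex.le_one {d : ℕ} (s : Simplex d) (k : Fin (d + 1)) : s.1 k ≤ 1 := by
  rw [← s.sum_eq_one]
  exact Finset.single_le_sum (fun i _ => s.nonneg i) (Finset.mem_univ k)

theorem Simplex.sum_sub_eq_zero {d : ℕ} (s t : Simplex d) : ∑ k, (t.1 k - s.1 k) = 0 := by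
  rw [Finset.sum_sub_distrib, s.sum_eq_one, t.sum_eq_one, sub_self]

/-- All coordinates are controlled by those of the chart. -/
theorem Simplex.abs_sub_le {d : ℕ} (s t : Simplex d) (k : Fin (d + 1)) :
    |t.1 k - s.1 k| ≤ (d + 1) * ‖simplexChart d t - simplexChart d s‖ := by
  set r := ‖simplexChart d t - simplexChart d s‖
  have hr : 0 ≤ r := norm_nonneg _
  have hc : ∀ i : Fin d, |t.1 i.castSucc - s.1 i.castSucc| ≤ r := fun i =>
    norm_le_pi_norm (simplexChart d t - simplexChart d s) i
  have hd : (0 : ℝ) ≤ d := Nat.cast_nonneg d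
  refine Fin.lastCases ?_ (fun i => (hc i).trans (by nlinarith)) k
  have h0 := s.sum_sub_eq_zero t
  rw [Fin.sum_univ_castSucc] at h0
  rw [eq_neg_of_add_eq_zero_right h0, abs_neg]
  calc |∑ i : Fin d, (t.1 i.castSucc - s.1 i.castSucc)|
      ≤ ∑ i : Fin d, |t.1 i.castSucc - s.1 i.castSucc| := Finset.abs_sum_le_sum_abs _ _
    _ ≤ ∑ _i : Fin d, r := Finset.sum_le_sum fun i _ => hc i
    _ = d * r := by simp
    _ ≤ (d + 1) * r := by nlinarith

theorem Simplex.norm_chart_sub_sq_le {d : ℕ} (s t : Simplex d) :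
    ‖simplexChart d t - simplexChart d s‖ ^ 2 ≤ ∑ k, (t.1 k - s.1 k) ^ 2 := by
  have h0 : 0 ≤ ∑ k, (t.1 k - s.1 k) ^ 2 := Finset.sum_nonneg fun k _ => sq_nonneg _
  refine Real.le_sqrt (norm_nonneg _) h0 |>.1 ?_
  refine (pi_norm_le_iff_of_nonneg (Real.sqrt_nonneg _)).2 fun i => ?_
  refine Real.abs_le_sqrt ?_
  exact Finset.single_le_sum (f := fun k => (t.1 k - s.1 k) ^ 2) (fun k _ => sq_nonneg _)
    (Finset.mem_univ i.castSucc)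

/-- The parameters sum to `1 / h + (d + 1)` whatever `t` is, so the Gamma factor in front is
independent of `t` and drops out of all comparisons between kernel values. -/
theorem dirichletKernel_eq_exp {d : ℕ} {h : ℝ} (hh : 0 < h) {s : Simplex d}
    (hs : s ∈ simplexInterior d) (t : Simplex d) :
    dirichletKernel h s t = Real.Gamma (1 / h + (d + 1)) *
      Real.exp (∑ k, (t.1 k / h * Real.log (s.1 k) - logGammaSucc (t.1 k / h))) := by
  have hsum : ∑ k, (t.1 k / h + 1) = 1 / h + (d + 1) := by
    rw [Finset.sum_add_distrib, ← Finset.sum_div, t.sum_eq_one]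
    simp
  rw [dirichletKernel, hsum, Real.exp_sum, div_mul_eq_mul_div, mul_div_assoc,
    ← Finset.prod_div_distrib]
  congr 1
  refine Finset.prod_congr rfl fun k _ => ?_
  have hG : 0 < Real.Gamma (t.1 k / h + 1) :=
    Real.Gamma_pos_of_pos (by have := div_nonneg (t.nonneg k) hh.le; linarith)
  rw [add_sub_cancel_right, Real.exp_sub, logGammaSucc, Real.exp_log hG,
    Real.rpow_def_of_pos (hs k), mul_comm]

theorem dirichletKernel_pos {d : ℕ} {h : ℝ} (hh : 0 < h) {s : Simplex d}
    (hs : s ∈ simplexInterior d) (t : Simplex d) : 0 < dirichletKernel h s t := by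
  rw [dirichletKernel_eq_exp hh hs]
  exact mul_pos (Real.Gamma_pos_of_pos (by positivity)) (Real.exp_pos _)

/-- Splitting `log (s_k / h)` leaves a term in `log h` multiplied by the sum of `t_k - s_k`, which
is zero. Hence the linear terms of the log Γ estimates match the linear part of the kernel exponent
exactly. -/
theorem sum_mul_log_div {d : ℕ} {h : ℝ} (hh : 0 < h) {s : Simplex d}
    (hs : s ∈ simplexInterior d) (t : Simplex d) :
    ∑ k, (t.1 k / h - s.1 k / h) * Real.log (s.1 k / h)
      = ∑ k, (t.1 k / h * Real.log (s.1 k) - s.1 k / h * Real.log (s.1 k)) := by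
  have h0 : ∑ k, (t.1 k - s.1 k) / h * Real.log h = 0 := by
    rw [← Finset.sum_mul, ← Finset.sum_div, s.sum_sub_eq_zero t]
    simp
  rw [← sub_eq_zero, ← Finset.sum_sub_distrib, ← neg_eq_zero, ← Finset.sum_neg_distrib, ← h0]
  refine Finset.sum_congr rfl fun k _ => ?_
  rw [Real.log_div (hs k).ne' hh.ne']
  ring

/-- Gaussian upper bound for the Dirichlet kernel in its second argument. -/
theorem dirichletKernel_le {d : ℕ} {h : ℝ} (hh : 0 < h) {s : Simplex d}
    (hs : s ∈ simplexInterior d) (t : Simplex d) :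
    dirichletKernel h s t ≤ dirichletKernel h s s *
      Real.exp ((d + 1) - ‖simplexChart d t - simplexChart d s‖ ^ 2 / (4 * h)) := by
  rw [dirichletKernel_eq_exp hh hs, dirichletKernel_eq_exp hh hs, mul_assoc, ← Real.exp_add]
  have hG : 0 < Real.Gamma (1 / h + (d + 1)) := Real.Gamma_pos_of_pos (by positivity)
  refine mul_le_mul_of_nonneg_left (Real.exp_le_exp.2 ?_) hG.le
  -- `N = 1 / h` dominates all `s_k / h` and `t_k / h`, so the quadratic gain becomes `(t_k - s_k)²
  -- / (4h)`. The loss of 1 per coordinate adds up to the `d + 1` in the exponent.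
  have key := Finset.sum_le_sum fun (k : Fin (d + 1)) (_ : k ∈ Finset.univ) =>
    logGammaSucc_sub_ge (a := s.1 k / h) (x := t.1 k / h) (N := 1 / h) (div_pos (hs k) hh)
      (div_le_div_of_nonneg_right (s.le_one k) hh.le) (div_nonneg (t.nonneg k) hh.le)
      (div_le_div_of_nonneg_right (t.le_one k) hh.le)
  rw [Finset.sum_sub_distrib, Finset.sum_add_distrib, sum_mul_log_div hh hs] at key
  have h1 : ∑ k, (t.1 k / h - s.1 k / h) ^ 2 / (4 * (1 / h))
      = (∑ k, (t.1 k - s.1 k) ^ 2) / (4 * h) := by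
    rw [Finset.sum_div]
    refine Finset.sum_congr rfl fun k _ => ?_
    field_simp
  have h2 : ‖simplexChart d t - simplexChart d s‖ ^ 2 / (4 * h)
      ≤ (∑ k, (t.1 k - s.1 k) ^ 2) / (4 * h) := by
    gcongr
    exact s.norm_chart_sub_sq_le t
  rw [h1] at key
  simp only [Finset.sum_sub_distrib, Finset.sum_const, Finset.card_univ, Fintype.card_fin,
    nsmul_eq_mul, mul_one, Nat.cast_add, Nat.cast_one] at key ⊢
  linarith

theorem Simplex.exists_pos_le {d : ℕ} {s : Simplex d} (hs : s ∈ simplexInterior d) :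
    ∃ σ > 0, ∀ k, σ ≤ s.1 k := by
  obtain ⟨k, hk⟩ := Finite.exists_min s.1
  exact ⟨s.1 k, hs k, hk⟩

/-- Lower bound for the Dirichlet kernel near the diagonal. -/
theorem exists_le_dirichletKernel {d : ℕ} {s : Simplex d} (hs : s ∈ simplexInterior d) :
    ∃ c > 0, ∀ᶠ h in 𝓝[>] (0 : ℝ), ∀ t : Simplex d,
      ‖simplexChart d t - simplexChart d s‖ ≤ √h →
        c * dirichletKernel h s s ≤ dirichletKernel h s t := by
  obtain ⟨σ, hσ, hmin⟩ := s.exists_pos_le hs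
  refine ⟨Real.exp (-((d + 1) * ((2 * (d + 1) ^ 2 + σ) / σ))), Real.exp_pos _, ?_⟩
  have hlim : Tendsto (fun h : ℝ => (d + 1) * √h) (𝓝[>] 0) (𝓝 0) := by
    have : Continuous fun h : ℝ => (d + 1) * √h := by fun_prop
    simpa using (this.tendsto 0).mono_left nhdsWithin_le_nhds
  -- Once `(d + 1) * √h ≤ σ / 2`, every such `t` satisfies `s_k ≤ 2 t_k`, as the upper log Γ
  -- estimate requires. At distance of order `√h` its error is bounded independently of `h`.
  filter_upwards [hlim.eventually (ge_mem_nhds (show (0 : ℝ) < σ / 2 by positivity)),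
    self_mem_nhdsWithin] with h hhσ (hh : 0 < h) t ht
  rw [dirichletKernel_eq_exp hh hs, dirichletKernel_eq_exp hh hs, mul_left_comm, ← Real.exp_add]
  have hG : 0 < Real.Gamma (1 / h + (d + 1)) := Real.Gamma_pos_of_pos (by positivity)
  refine mul_le_mul_of_nonneg_left (Real.exp_le_exp.2 ?_) hG.le
  have hts : ∀ k, |t.1 k - s.1 k| ≤ (d + 1) * √h := fun k =>
    (s.abs_sub_le t k).trans (by gcongr)
  have hbound : ∀ k, logGammaSucc (t.1 k / h) - logGammaSucc (s.1 k / h) ≤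
      (t.1 k / h - s.1 k / h) * Real.log (s.1 k / h) + (2 * (d + 1) ^ 2 + σ) / σ := by
    intro k
    have h1 := abs_le.1 ((hts k).trans hhσ)
    have h2 := hmin k
    have ht0 : s.1 k ≤ 2 * t.1 k := by linarith
    have hs0 := hs k
    refine (logGammaSucc_sub_le (div_pos (by linarith) hh) ?_ (div_pos hs0 hh)).trans ?_
    · rw [← mul_div_assoc]
      gcongr
    · refine add_le_add le_rfl ?_
      have e1 : (2 * (t.1 k / h - s.1 k / h) ^ 2 + |t.1 k / h - s.1 k / h|) / (s.1 k / h)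
          = (2 * ((t.1 k - s.1 k) ^ 2 / h) + |t.1 k - s.1 k|) / s.1 k := by
        rw [← sub_div, abs_div, abs_of_pos hh]
        field_simp
      rw [e1]
      have e2 : (t.1 k - s.1 k) ^ 2 / h ≤ (d + 1) ^ 2 := by
        rw [div_le_iff₀ hh, ← sq_abs]
        calc |t.1 k - s.1 k| ^ 2 ≤ ((d + 1) * √h) ^ 2 := by gcongr; exact hts k
          _ = (d + 1) ^ 2 * h := by rw [mul_pow, Real.sq_sqrt hh.le]
      have e3 : |t.1 k - s.1 k| ≤ σ := by linarith [hts k]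
      gcongr
  have key := Finset.sum_le_sum fun (k : Fin (d + 1)) (_ : k ∈ Finset.univ) => hbound k
  rw [Finset.sum_add_distrib, sum_mul_log_div hh hs] at key
  simp only [Finset.sum_sub_distrib, Finset.sum_const, Finset.card_univ, Fintype.card_fin,
    nsmul_eq_mul, Nat.cast_add, Nat.cast_one] at key ⊢
  linarith

/-! ### Lebesgue measure of the simplex through the chart -/

theorem continuous_simplexChart (d : ℕ) : Continuous (simplexChart d) :=
  continuous_pi fun i => (continuous_apply i.castSucc).comp continuous_subtype_val

instance Simplex.instCompactSpace (d : ℕ) : CompactSpace (Simplex d) :=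
  isCompact_iff_compactSpace.mp (isCompact_stdSimplex ℝ _)

theorem map_simplexChart_simplexVolume (d : ℕ) :
    (simplexVolume d).map (simplexChart d) = volume.restrict (Set.range (simplexChart d)) :=
  (simplexChart_measurableEmbedding d).map_comap _

theorem integral_comp_simplexChart {d : ℕ} (g : (Fin d → ℝ) → ℝ) :
    ∫ t, g (simplexChart d t) ∂simplexVolume d = ∫ u in Set.range (simplexChart d), g u := by
  rw [← map_simplexChart_simplexVolume, (simplexChart_measurableEmbedding d).integral_map]

theorem integrable_comp_simplexChart {d : ℕ} {g : (Fin d → ℝ) → ℝ} (hg : Integrable g) :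
    Integrable (fun t => g (simplexChart d t)) (simplexVolume d) := by
  have := (simplexChart_measurableEmbedding d).integrable_map_iff (μ := simplexVolume d) (g := g)
  rw [map_simplexChart_simplexVolume] at this
  exact this.1 hg.integrableOn

instance simplexVolume.instIsFiniteMeasure (d : ℕ) : IsFiniteMeasure (simplexVolume d) := by
  constructor
  have h := Measure.map_apply (μ := simplexVolume d) (continuous_simplexChart d).measurable
    MeasurableSet.univ
  rw [Set.preimage_univ, map_simplexChart_simplexVolume, Measure.restrict_apply_univ] at h
  rw [← h]
  exact (isCompact_range (continuous_simplexChart d)).measure_lt_top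

/-- Points of the chart with nonnegative coordinates of sum at most one come from the simplex. -/
theorem mem_range_simplexChart {d : ℕ} {u : Fin d → ℝ} (h0 : ∀ i, 0 ≤ u i) (h1 : ∑ i, u i ≤ 1) :
    u ∈ Set.range (simplexChart d) := by
  refine ⟨⟨Fin.snoc u (1 - ∑ i, u i), fun k => ?_, ?_⟩, ?_⟩
  · refine Fin.lastCases ?_ (fun i => ?_) k
    · simpa using h1
    · simpa using h0 i
  · simp [Fin.sum_univ_castSucc]
  · funext i
    simp [simplexChart]

theorem closedBall_subset_range_simplexChart {d : ℕ} {s : Simplex d} {r σ : ℝ}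
    (hσ : ∀ k, σ ≤ s.1 k) (hr : (d + 1) * r ≤ σ) (hr0 : 0 ≤ r) :
    Metric.closedBall (simplexChart d s) r ⊆ Set.range (simplexChart d) := by
  intro u hu
  have hd : (0 : ℝ) ≤ d := Nat.cast_nonneg d
  have hc : ∀ i, |u i - s.1 i.castSucc| ≤ r := fun i =>
    (norm_le_pi_norm (u - simplexChart d s) i).trans (by simpa [dist_eq_norm] using hu)
  refine mem_range_simplexChart (fun i => ?_) ?_
  · have := (abs_le.1 (hc i)).1
    have := hσ i.castSucc
    nlinarith
  · have h1 : ∑ i, u i ≤ ∑ i : Fin d, (s.1 i.castSucc + r) :=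
      Finset.sum_le_sum fun i _ => by linarith [(abs_le.1 (hc i)).2]
    have h2 := s.sum_eq_one
    rw [Fin.sum_univ_castSucc] at h2
    have := hσ (Fin.last d)
    rw [Finset.sum_add_distrib] at h1
    simp only [Finset.sum_const, Finset.card_univ, Fintype.card_fin, nsmul_eq_mul] at h1
    nlinarith

theorem eventually_closedBall_subset_range {d : ℕ} {s : Simplex d} (hs : s ∈ simplexInterior d) :
    ∀ᶠ r in 𝓝[>] (0 : ℝ),
      Metric.closedBall (simplexChart d s) r ⊆ Set.range (simplexChart d) := by
  obtain ⟨σ, hσ, hmin⟩ := s.exists_pos_le hs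
  have hlim : Tendsto (fun r : ℝ => (d + 1) * r) (𝓝[>] 0) (𝓝 0) := by
    have : Continuous fun r : ℝ => ((d : ℝ) + 1) * r := by fun_prop
    simpa using (this.tendsto 0).mono_left nhdsWithin_le_nhds
  filter_upwards [hlim.eventually (ge_mem_nhds hσ), self_mem_nhdsWithin] with r hr hr0
  exact closedBall_subset_range_simplexChart hmin hr (le_of_lt hr0)

theorem simplexVolume_real_preimage_closedBall {d : ℕ} {u : Fin d → ℝ} {r : ℝ} (hr : 0 ≤ r)
    (hsub : Metric.closedBall u r ⊆ Set.range (simplexChart d)) :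
    (simplexVolume d).real (simplexChart d ⁻¹' Metric.closedBall u r) = (2 * r) ^ d := by
  rw [measureReal_def, ← Measure.map_apply (continuous_simplexChart d).measurable
    Metric.isClosed_closedBall.measurableSet, map_simplexChart_simplexVolume,
    Measure.restrict_apply Metric.isClosed_closedBall.measurableSet,
    Set.inter_eq_left.2 hsub, Real.volume_pi_closedBall _ hr, Fintype.card_fin,
    ENNReal.toReal_ofReal (by positivity)]

/-! ### Mass and domination of the kernel -/

theorem continuous_dirichletKernel {d : ℕ} {h : ℝ} (hh : 0 < h) {s : Simplex d}
    (hs : s ∈ simplexInterior d) : Continuous fun t => dirichletKernel h s t := by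
  have hlg : ContinuousOn logGammaSucc (Set.Ici 0) := by
    intro x hx
    have hx0 : 0 < x + 1 := by have : 0 ≤ x := hx; linarith
    have hG : ContinuousAt (fun x : ℝ => Real.Gamma (x + 1)) x :=
      ContinuousAt.comp (f := fun x : ℝ => x + 1)
        (Real.differentiableAt_Gamma fun m => by
          have : (0 : ℝ) ≤ m := m.cast_nonneg
          intro h; linarith).continuousAt (by fun_prop)
    exact (hG.log (Real.Gamma_pos_of_pos hx0).ne').continuousWithinAt
  have hk : ∀ k, Continuous fun t : Simplex d => t.1 k := fun k =>
    (continuous_apply k).comp continuous_subtype_val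
  simp_rw [dirichletKernel_eq_exp hh hs]
  refine continuous_const.mul (Real.continuous_exp.comp (continuous_finsetSum _ fun k _ => ?_))
  refine (((hk k).div_const h).mul continuous_const).sub ?_
  exact hlg.comp_continuous ((hk k).div_const h) fun t => div_nonneg (t.nonneg k) hh.le

theorem integrable_dirichletKernel {d : ℕ} {h : ℝ} (hh : 0 < h) {s : Simplex d}
    (hs : s ∈ simplexInterior d) :
    Integrable (fun t => dirichletKernel h s t) (simplexVolume d) :=
  (continuous_dirichletKernel hh hs).integrable_of_hasCompactSupport
    (HasCompactSupport.of_compactSpace _)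

/-- From `1 + v ≤ exp v` and completing the square. It trades the Gaussian for a power profile,
whose integrability and scaling are simple. -/
theorem exp_neg_sq_le_rpow (a : ℝ) {v : ℝ} (hv : 0 ≤ v) (ha : 0 ≤ a) :
    Real.exp (-v ^ 2 / 4) ≤ Real.exp (a ^ 2) * (1 + v) ^ (-a) := by
  rw [Real.rpow_neg (by positivity), ← div_eq_mul_inv, le_div_iff₀ (by positivity)]
  calc Real.exp (-v ^ 2 / 4) * (1 + v) ^ a
      ≤ Real.exp (-v ^ 2 / 4) * (Real.exp v) ^ a := by
        gcongr
        linarith [Real.add_one_le_exp v]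
    _ = Real.exp (-v ^ 2 / 4 + v * a) := by rw [← Real.exp_mul, ← Real.exp_add]
    _ ≤ Real.exp (a ^ 2) := by
        refine Real.exp_le_exp.2 ?_
        nlinarith [sq_nonneg (v / 2 - a)]

/-- The normalized Dirichlet kernel is dominated by a rescaled integrable profile. -/
theorem exists_dirichletKernel_le_integral_mul {d : ℕ} {s : Simplex d}
    (hs : s ∈ simplexInterior d) :
    ∃ C > 0, ∀ᶠ h in 𝓝[>] (0 : ℝ), 0 < ∫ t, dirichletKernel h s t ∂simplexVolume d ∧
      ∀ t, dirichletKernel h s t ≤ (∫ t, dirichletKernel h s t ∂simplexVolume d) *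
        (C * (√h ^ d)⁻¹ *
          (1 + ‖simplexChart d t - simplexChart d s‖ / √h) ^ (-(d + 2 : ℝ))) := by
  obtain ⟨c, hc, hlow⟩ := exists_le_dirichletKernel hs
  have hsqrt : Tendsto (fun h : ℝ => √h) (𝓝[>] 0) (𝓝[>] 0) := by
    refine tendsto_nhdsWithin_iff.2 ⟨?_, ?_⟩
    · simpa using (Real.continuous_sqrt.tendsto 0).mono_left nhdsWithin_le_nhds
    · filter_upwards [self_mem_nhdsWithin] with h hh using Real.sqrt_pos.2 hh
  -- The factors come from the Gaussian bound and from passing to a power of exponent `d + 2`;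
  -- dividing by `c * 2 ^ d` accounts for the lower bound on the integral.
  set A := Real.exp (d + 1) * Real.exp ((d + 2 : ℝ) ^ 2)
  refine ⟨A / (c * 2 ^ d), by positivity, ?_⟩
  filter_upwards [hlow, hsqrt.eventually (eventually_closedBall_subset_range hs),
    self_mem_nhdsWithin] with h hlow hball (hh : 0 < h)
  have hq : 0 < √h := Real.sqrt_pos.2 hh
  set I := ∫ t, dirichletKernel h s t ∂simplexVolume d with hI
  have hkpos := dirichletKernel_pos hh hs s
  -- Only the cube of radius `√h` is kept: there the kernel is comparable to its value at `t = s`,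
  -- and the cube lies inside the chart, so its volume is exactly `(2 * √h) ^ d`.
  have hIlow : c * dirichletKernel h s s * (2 * √h) ^ d ≤ I := by
    set S := simplexChart d ⁻¹' Metric.closedBall (simplexChart d s) √h
    have hS : MeasurableSet S :=
      (continuous_simplexChart d).measurable Metric.isClosed_closedBall.measurableSet
    rw [← simplexVolume_real_preimage_closedBall hq.le hball]
    calc c * dirichletKernel h s s * (simplexVolume d).real S
        = ∫ _ in S, c * dirichletKernel h s s ∂simplexVolume d := by
          rw [setIntegral_const, smul_eq_mul, mul_comm]
      _ ≤ ∫ t in S, dirichletKernel h s t ∂simplexVolume d := by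
          refine setIntegral_mono_on (integrable_const _).integrableOn
            (integrable_dirichletKernel hh hs).integrableOn hS fun t ht => hlow t ?_
          simpa [S, dist_eq_norm] using ht
      _ ≤ I := setIntegral_le_integral (integrable_dirichletKernel hh hs)
          (Eventually.of_forall fun t => (dirichletKernel_pos hh hs t).le)
  refine ⟨lt_of_lt_of_le (by positivity) hIlow, fun t => ?_⟩
  set r := ‖simplexChart d t - simplexChart d s‖
  have hr : 0 ≤ r := norm_nonneg _
  calc dirichletKernel h s t
      ≤ dirichletKernel h s s * Real.exp ((d + 1) - r ^ 2 / (4 * h)) := dirichletKernel_le hh hs t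
    _ = dirichletKernel h s s * (Real.exp (d + 1) * Real.exp (-(r / √h) ^ 2 / 4)) := by
        rw [← Real.exp_add, div_pow, Real.sq_sqrt hh.le]
        congr 2
        field_simp
        ring
    _ ≤ dirichletKernel h s s * (Real.exp (d + 1) *
          (Real.exp ((d + 2 : ℝ) ^ 2) * (1 + r / √h) ^ (-(d + 2 : ℝ)))) := by
        gcongr
        exact exp_neg_sq_le_rpow _ (by positivity) (by positivity)
    _ = (c * dirichletKernel h s s * (2 * √h) ^ d) *
          (A / (c * 2 ^ d) * (√h ^ d)⁻¹ * (1 + r / √h) ^ (-(d + 2 : ℝ))) := by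
        rw [mul_pow]
        field_simp
        rfl
    _ ≤ _ := by gcongr

/-! ### Lebesgue points and the approximate identity -/

/-- `s` is a Lebesgue point of `ρ` with value `a`, in terms of small cubes of the chart. -/
def IsLebesguePoint {d : ℕ} (ρ : Simplex d → ℝ) (s : Simplex d) (a : ℝ) : Prop :=
  Tendsto (fun r : ℝ => (r ^ d)⁻¹ *
    ∫ t in simplexChart d ⁻¹' Metric.closedBall (simplexChart d s) r, |ρ t - a| ∂simplexVolume d)
    (𝓝[>] 0) (𝓝 0)

/-- Enlarging the domain from the image of the simplex to all of `ℝ^d` and rescaling by `q` gives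
the factor `q ^ d`. The exponent `d + 1` exceeds the dimension, so the profile is integrable. -/
theorem integral_rpow_profile_le {d : ℕ} (s : Simplex d) {q : ℝ} (hq : 0 < q) :
    Integrable (fun t => (1 + ‖simplexChart d t - simplexChart d s‖ / q) ^ (-(d + 1 : ℝ)))
      (simplexVolume d) ∧
    ∫ t, (1 + ‖simplexChart d t - simplexChart d s‖ / q) ^ (-(d + 1 : ℝ)) ∂simplexVolume d
      ≤ q ^ d * ∫ v : Fin d → ℝ, (1 + ‖v‖) ^ (-(d + 1 : ℝ)) := by
  have hint : Integrable fun v : Fin d → ℝ => (1 + ‖v‖) ^ (-(d + 1 : ℝ)) :=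
    integrable_one_add_norm (by simp)
  have heq : ∀ u : Fin d → ℝ, (1 + ‖u - simplexChart d s‖ / q) ^ (-(d + 1 : ℝ))
      = (1 + ‖q⁻¹ • (u - simplexChart d s)‖) ^ (-(d + 1 : ℝ)) := fun u => by
    rw [norm_smul, norm_inv, Real.norm_of_nonneg hq.le, div_eq_inv_mul]
  have hint' : Integrable fun u : Fin d → ℝ =>
      (1 + ‖u - simplexChart d s‖ / q) ^ (-(d + 1 : ℝ)) := by
    simp_rw [heq]
    exact ((integrable_comp_smul_iff volume _ (inv_ne_zero hq.ne')).2 hint).comp_sub_right _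
  refine ⟨integrable_comp_simplexChart hint', ?_⟩
  rw [integral_comp_simplexChart fun u => (1 + ‖u - simplexChart d s‖ / q) ^ (-(d + 1 : ℝ))]
  refine (setIntegral_le_integral hint' (Eventually.of_forall fun u => by positivity)).trans ?_
  simp_rw [heq]
  rw [integral_sub_right_eq_self fun u : Fin d → ℝ => (1 + ‖q⁻¹ • u‖) ^ (-(d + 1 : ℝ)),
    Measure.integral_comp_smul_of_nonneg volume
      (fun v : Fin d → ℝ => (1 + ‖v‖) ^ (-(d + 1 : ℝ))) q⁻¹ (hR := by positivity)]
  simp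

/-- The normalized Dirichlet kernel is an approximate identity at Lebesgue points of bounded
functions. -/
theorem IsLebesguePoint.tendsto_dirichletKernel {d : ℕ} {s : Simplex d}
    (hs : s ∈ simplexInterior d) {ρ : Simplex d → ℝ} {a B : ℝ} (hρ : Measurable ρ)
    (hB : ∀ᵐ t ∂simplexVolume d, |ρ t| ≤ B) (ha : IsLebesguePoint ρ s a) :
    Tendsto (fun h => (∫ t, dirichletKernel h s t * ρ t ∂simplexVolume d) /
      ∫ t, dirichletKernel h s t ∂simplexVolume d) (𝓝[>] 0) (𝓝 a) := by
  obtain ⟨C, hC, hker⟩ := exists_dirichletKernel_le_integral_mul hs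
  set M := ∫ v : Fin d → ℝ, (1 + ‖v‖) ^ (-(d + 1 : ℝ))
  have hM : 0 ≤ M := integral_nonneg fun v => by positivity
  set B' := max B 0 + |a| with hB'
  have hB'0 : 0 ≤ B' := by positivity
  have hbd : ∀ᵐ t ∂simplexVolume d, |ρ t - a| ≤ B' := by
    filter_upwards [hB] with t ht
    exact (abs_sub _ _).trans (add_le_add (ht.trans (le_max_left _ _)) le_rfl)
  have hdint : Integrable (fun t => |ρ t - a|) (simplexVolume d) :=
    Integrable.of_bound ((hρ.sub_const a).abs.aestronglyMeasurable) B'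
      (by simpa using hbd)
  rw [Metric.tendsto_nhds]
  intro ε hε
  -- `R` is fixed before `h`: the contribution from beyond `R * √h` is below `ε / 2` uniformly in
  -- small `h`, and the Lebesgue point condition at radius `R * √h` handles the rest.
  obtain ⟨R, hR, hRε⟩ : ∃ R : ℝ, 0 < R ∧ C * (B' / (1 + R)) * M < ε / 2 := by
    have : Tendsto (fun R : ℝ => C * (B' / (1 + R)) * M) atTop (𝓝 (C * 0 * M)) :=
      ((Tendsto.div_atTop tendsto_const_nhds
        (tendsto_atTop_add_const_left _ _ tendsto_id)).const_mul C).mul_const M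
    simp only [mul_zero, zero_mul] at this
    obtain ⟨R, h1, h2⟩ :=
      ((eventually_gt_atTop (0 : ℝ)).and (this.eventually (gt_mem_nhds (half_pos hε)))).exists
    exact ⟨R, h1, h2⟩
  have hscale : Tendsto (fun h : ℝ => R * √h) (𝓝[>] 0) (𝓝[>] 0) := by
    refine tendsto_nhdsWithin_iff.2 ⟨?_, ?_⟩
    · have : Continuous fun h : ℝ => R * √h := by fun_prop
      simpa using (this.tendsto 0).mono_left nhdsWithin_le_nhds
    · filter_upwards [self_mem_nhdsWithin] with h hh using mul_pos hR (Real.sqrt_pos.2 hh)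
  have hnear := ((ha.comp hscale).const_mul (C * R ^ d))
  rw [mul_zero] at hnear
  filter_upwards [hker, hnear.eventually (gt_mem_nhds (half_pos hε)), self_mem_nhdsWithin]
    with h ⟨hI, hk⟩ hn (hh : 0 < h)
  have hq : 0 < √h := Real.sqrt_pos.2 hh
  set I := ∫ t, dirichletKernel h s t ∂simplexVolume d
  set S := simplexChart d ⁻¹' Metric.closedBall (simplexChart d s) (R * √h) with hS_def
  have hS : MeasurableSet S :=
    (continuous_simplexChart d).measurable Metric.isClosed_closedBall.measurableSet
  have hkint := integrable_dirichletKernel hh hs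
  have hkρ : Integrable (fun t => dirichletKernel h s t * ρ t) (simplexVolume d) := by
    refine hkint.mul_bdd (c := B) hρ.aestronglyMeasurable ?_
    simpa using hB
  obtain ⟨hpint, hple⟩ := integral_rpow_profile_le s hq
  have e1 : (∫ t, dirichletKernel h s t * ρ t ∂simplexVolume d) / I - a
      = ∫ t, dirichletKernel h s t / I * (ρ t - a) ∂simplexVolume d := by
    have : (fun t => dirichletKernel h s t / I * (ρ t - a))
        = fun t => (dirichletKernel h s t * ρ t - a * dirichletKernel h s t) / I := by
      funext t; ring
    rw [this, integral_div, integral_sub hkρ (hkint.const_mul a), integral_const_mul, sub_div,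
      mul_div_assoc a, div_self hI.ne', mul_one]
  rw [Real.dist_eq, e1]
  -- Inside the cube the profile is bounded by 1. Outside, one of the `d + 2` powers supplies the
  -- small factor `1 / (1 + R)` and the remaining `d + 1` stay integrable.
  have hdom : ∀ᵐ t ∂simplexVolume d, ‖dirichletKernel h s t / I * (ρ t - a)‖ ≤
      C * (√h ^ d)⁻¹ * S.indicator (fun t => |ρ t - a|) t +
        C * (√h ^ d)⁻¹ * (B' / (1 + R)) *
          (1 + ‖simplexChart d t - simplexChart d s‖ / √h) ^ (-(d + 1 : ℝ)) := by
    filter_upwards [hbd] with t ht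
    set v := ‖simplexChart d t - simplexChart d s‖ / √h with hv
    have hv0 : 0 ≤ v := by positivity
    have hk1 : dirichletKernel h s t / I ≤ C * (√h ^ d)⁻¹ * (1 + v) ^ (-(d + 2 : ℝ)) := by
      rw [div_le_iff₀ hI, mul_comm]
      exact hk t
    rw [norm_mul, Real.norm_of_nonneg (div_nonneg (dirichletKernel_pos hh hs t).le hI.le),
      Real.norm_eq_abs]
    by_cases htS : t ∈ S
    · rw [Set.indicator_of_mem htS]
      have h1 : (1 + v) ^ (-(d + 2 : ℝ)) ≤ 1 :=
        Real.rpow_le_one_of_one_le_of_nonpos (by linarith) (by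
          have : (0 : ℝ) ≤ d := Nat.cast_nonneg d
          linarith)
      have h2 : dirichletKernel h s t / I ≤ C * (√h ^ d)⁻¹ :=
        hk1.trans (mul_le_of_le_one_right (by positivity) h1)
      have h3 : 0 ≤ C * (√h ^ d)⁻¹ * (B' / (1 + R)) * (1 + v) ^ (-(d + 1 : ℝ)) := by positivity
      have h4 := mul_le_mul_of_nonneg_right h2 (abs_nonneg (ρ t - a))
      linarith
    · rw [Set.indicator_of_notMem htS, mul_zero, zero_add]
      have hvR : R ≤ v := by
        rw [hv, le_div_iff₀ hq]
        by_contra hlt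
        exact htS (by simpa [hS_def, dist_eq_norm] using (not_le.1 hlt).le)
      calc dirichletKernel h s t / I * |ρ t - a|
          ≤ C * (√h ^ d)⁻¹ * (1 + v) ^ (-(d + 2 : ℝ)) * B' := by gcongr
        _ = C * (√h ^ d)⁻¹ * (B' * (1 + v)⁻¹) * (1 + v) ^ (-(d + 1 : ℝ)) := by
            have : (-(d + 2 : ℝ)) = -1 + -(d + 1 : ℝ) := by ring
            rw [this, Real.rpow_add (by positivity), Real.rpow_neg_one]
            ring
        _ ≤ C * (√h ^ d)⁻¹ * (B' / (1 + R)) * (1 + v) ^ (-(d + 1 : ℝ)) := by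
            rw [div_eq_mul_inv]
            gcongr
  calc |∫ t, dirichletKernel h s t / I * (ρ t - a) ∂simplexVolume d|
      ≤ ∫ t, (C * (√h ^ d)⁻¹ * S.indicator (fun t => |ρ t - a|) t +
        C * (√h ^ d)⁻¹ * (B' / (1 + R)) *
          (1 + ‖simplexChart d t - simplexChart d s‖ / √h) ^ (-(d + 1 : ℝ)))
          ∂simplexVolume d :=
        norm_integral_le_of_norm_le
          (((hdint.indicator hS).const_mul _).add (hpint.const_mul _)) hdom
    _ = C * (√h ^ d)⁻¹ * (∫ t in S, |ρ t - a| ∂simplexVolume d) +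
        C * (√h ^ d)⁻¹ * (B' / (1 + R)) *
          ∫ t, (1 + ‖simplexChart d t - simplexChart d s‖ / √h) ^ (-(d + 1 : ℝ))
            ∂simplexVolume d := by
        rw [integral_add ((hdint.indicator hS).const_mul _) (hpint.const_mul _),
          integral_const_mul, integral_const_mul, integral_indicator hS]
    _ ≤ C * (√h ^ d)⁻¹ * (∫ t in S, |ρ t - a| ∂simplexVolume d) +
        C * (√h ^ d)⁻¹ * (B' / (1 + R)) * (√h ^ d * M) := by gcongr
    _ = C * R ^ d * (((R * √h) ^ d)⁻¹ * ∫ t in S, |ρ t - a| ∂simplexVolume d) +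
        C * (B' / (1 + R)) * M := by
        rw [mul_pow]
        field_simp
    _ < ε / 2 + ε / 2 := add_lt_add hn hRε
    _ = ε := add_halves ε

/-- Points of continuity in the interior are Lebesgue points. -/
theorem ContinuousAt.isLebesguePoint {d : ℕ} {s : Simplex d} (hs : s ∈ simplexInterior d)
    {ρ : Simplex d → ℝ} (hρ : ContinuousAt ρ s) : IsLebesguePoint ρ s (ρ s) := by
  unfold IsLebesguePoint
  rw [Metric.tendsto_nhds]
  intro ε hε
  -- The factor `2 ^ d` compensates for the cube volume `(2 * r) ^ d` against the normalization `r ^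
  -- d`; the other 2 makes the final inequality strict.
  obtain ⟨δ, hδ, hδε⟩ := Metric.continuousAt_iff.1 hρ (ε / (2 * 2 ^ d)) (by positivity)
  have hlim : Tendsto (fun r : ℝ => ((d : ℝ) + 1) * r) (𝓝[>] 0) (𝓝 0) := by
    have : Continuous fun r : ℝ => ((d : ℝ) + 1) * r := by fun_prop
    simpa using (this.tendsto 0).mono_left nhdsWithin_le_nhds
  filter_upwards [hlim.eventually (gt_mem_nhds hδ), eventually_closedBall_subset_range hs,
    self_mem_nhdsWithin] with r hr hsub (hr0 : 0 < r)
  set S := simplexChart d ⁻¹' Metric.closedBall (simplexChart d s) r with hS_def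
  have hbound : ∀ t ∈ S, ‖|ρ t - ρ s|‖ ≤ ε / (2 * 2 ^ d) := by
    intro t ht
    rw [Real.norm_eq_abs, abs_abs]
    refine (hδε (lt_of_le_of_lt ?_ hr)).le
    refine (dist_pi_le_iff (by positivity)).2 fun k => ?_
    refine (s.abs_sub_le t k).trans ?_
    gcongr
    simpa [hS_def, dist_eq_norm] using ht
  have h1 := norm_setIntegral_le_of_norm_le_const (μ := simplexVolume d) (s := S)
    (measure_lt_top _ _) hbound
  rw [simplexVolume_real_preimage_closedBall hr0.le hsub] at h1
  rw [Real.dist_eq, sub_zero, abs_mul, abs_of_pos (by positivity : 0 < (r ^ d)⁻¹)]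
  calc (r ^ d)⁻¹ * |∫ t in S, |ρ t - ρ s| ∂simplexVolume d|
      ≤ (r ^ d)⁻¹ * (ε / (2 * 2 ^ d) * (2 * r) ^ d) := by gcongr; exact h1
    _ = ε / 2 := by rw [mul_pow]; field_simp
    _ < ε := half_lt_self hε

/-- Almost every point is a Lebesgue point of an integrable function. -/
theorem ae_isLebesguePoint {d : ℕ} {ρ : Simplex d → ℝ} (hρ : Integrable ρ (simplexVolume d)) :
    ∀ᵐ s ∂simplexVolume d, s ∈ simplexInterior d → IsLebesguePoint ρ s (ρ s) := by
  have hemb := simplexChart_measurableEmbedding d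
  -- Extension by zero moves the question to `ℝ^d`, where Lebesgue differentiation applies. At
  -- interior points small cubes stay inside the image, so the extension is invisible.
  set g : (Fin d → ℝ) → ℝ := Function.extend (simplexChart d) ρ 0 with hg
  have hgρ : ∀ t, g (simplexChart d t) = ρ t := fun t =>
    (simplexChart_injective d).extend_apply ρ 0 t
  have hgint : Integrable g := by
    have h1 : Integrable g ((simplexVolume d).map (simplexChart d)) := by
      rw [hemb.integrable_map_iff]
      exact hρ.congr (Eventually.of_forall fun t => (hgρ t).symm)
    rw [map_simplexChart_simplexVolume] at h1
    refine IntegrableOn.integrable_of_forall_notMem_eq_zero h1 fun u hu => ?_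
    exact Function.extend_apply' _ _ _ fun ⟨t, ht⟩ => hu ⟨t, ht⟩
  have hae := IsUnifLocDoublingMeasure.ae_tendsto_average_norm_sub
    (μ := (volume : Measure (Fin d → ℝ))) hgint.locallyIntegrable 1
  have hae' : ∀ᵐ s ∂simplexVolume d, Tendsto (fun r : ℝ =>
      ⨍ y in Metric.closedBall (simplexChart d s) r, ‖g y - g (simplexChart d s)‖)
      (𝓝[>] 0) (𝓝 0) := by
    have h2 : ∀ᵐ u ∂(simplexVolume d).map (simplexChart d), Tendsto (fun r : ℝ =>
        ⨍ y in Metric.closedBall u r, ‖g y - g u‖) (𝓝[>] 0) (𝓝 0) := by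
      rw [map_simplexChart_simplexVolume]
      refine ae_restrict_of_ae (hae.mono fun u hu => ?_)
      refine hu (fun _ => u) id tendsto_id ?_
      filter_upwards [self_mem_nhdsWithin] with r hr
      simpa using le_of_lt hr
    exact hemb.ae_map_iff.1 h2
  filter_upwards [hae'] with s hs hint
  -- The factor converts the average over a cube of volume `(2 * r) ^ d` into the normalization by
  -- `r ^ d`.
  have h3 := hs.const_mul ((2 : ℝ) ^ d)
  rw [mul_zero] at h3
  refine h3.congr' ?_
  filter_upwards [eventually_closedBall_subset_range hint, self_mem_nhdsWithin]
    with r hsub (hr : 0 < r)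
  have h4 : ∫ t in simplexChart d ⁻¹' Metric.closedBall (simplexChart d s) r,
      |ρ t - ρ s| ∂simplexVolume d
      = ∫ y in Metric.closedBall (simplexChart d s) r, ‖g y - g (simplexChart d s)‖ := by
    rw [← Set.inter_eq_left.2 hsub, ← Measure.restrict_restrict
      Metric.isClosed_closedBall.measurableSet, ← map_simplexChart_simplexVolume,
      hemb.setIntegral_map, Set.preimage_inter, Set.preimage_range, Set.inter_univ]
    simp_rw [hgρ, Real.norm_eq_abs]
  rw [h4, setAverage_eq, measureReal_def, Real.volume_pi_closedBall _ hr.le, Fintype.card_fin,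
    ENNReal.toReal_ofReal (by positivity), smul_eq_mul, mul_pow]
  field_simp

/-- Almost every point of the simplex lies in the interior. -/
theorem ae_mem_simplexInterior (d : ℕ) : ∀ᵐ s ∂simplexVolume d, s ∈ simplexInterior d := by
  have hnull : ∀ (L : (Fin d → ℝ) →ₗ[ℝ] ℝ) (b : ℝ), (∃ u, L u ≠ b) →
      ∀ᵐ s ∂simplexVolume d, L (simplexChart d s) ≠ b := by
    rintro L b ⟨u₀, hu₀⟩
    have h2 : ∀ᵐ u ∂(simplexVolume d).map (simplexChart d), L u ≠ b := by
      rw [map_simplexChart_simplexVolume]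
      refine ae_restrict_of_ae ?_
      set A := (AffineSubspace.mk' b (⊥ : Submodule ℝ ℝ)).comap L.toAffineMap
      have hmem : ∀ u, u ∈ A ↔ L u = b := fun u => by
        simp [A, AffineSubspace.mem_comap, sub_eq_zero]
      have hA : A ≠ ⊤ := fun h => hu₀ ((hmem u₀).1 (h ▸ AffineSubspace.mem_top ℝ _ u₀))
      have := measure_eq_zero_iff_ae_notMem.1 (Measure.addHaar_affineSubspace volume A hA)
      exact this.mono fun u hu h => hu ((hmem u).2 h)
    exact (simplexChart_measurableEmbedding d).ae_map_iff.1 h2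
  have hcoord : ∀ k : Fin (d + 1), ∀ᵐ s ∂simplexVolume d, s.1 k ≠ 0 := by
    intro k
    refine Fin.lastCases ?_ (fun i => ?_) k
    -- Vanishing of the dropped coordinate means that the chart coordinates sum to one. The witness
    -- 0 shows that this set is proper even for `d = 0`, where it is empty.
    · have := hnull (∑ i, LinearMap.proj i) 1 ⟨0, by simp⟩
      filter_upwards [this] with s hs h0
      have h1 := s.sum_eq_one
      rw [Fin.sum_univ_castSucc, h0, add_zero] at h1
      exact hs (by simpa [simplexChart] using h1)
    · exact hnull (LinearMap.proj i) 0 ⟨fun _ => 1, by simp⟩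
  filter_upwards [ae_all_iff.2 hcoord] with s hs k
  exact (s.nonneg k).lt_of_ne' (hs k)

/-! ### Weak law of large numbers and bandwidths -/

/-- A continuous function preserves joint convergence in measure to constants. -/
theorem TendstoInMeasure.comp_continuousAt {Ω ι E : Type*} [MeasurableSpace Ω] [Fintype ι]
    [PseudoMetricSpace E] {P : Measure Ω} {X : ℕ → ι → Ω → ℝ} {a : ι → ℝ}
    (hX : ∀ k, TendstoInMeasure P (fun n => X n k) atTop fun _ => a k)
    {F : (ι → ℝ) → E} (hF : ContinuousAt F a) :
    TendstoInMeasure P (fun n ω => F fun k => X n k ω) atTop fun _ => F a := by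
  rw [tendstoInMeasure_iff_dist]
  intro ε hε
  obtain ⟨δ, hδ, hδε⟩ := Metric.continuousAt_iff.1 hF ε hε
  have hsum : Tendsto (fun n => ∑ k, P {ω | δ ≤ dist (X n k ω) (a k)}) atTop (𝓝 0) := by
    have := tendsto_finsetSum Finset.univ fun k (_ : k ∈ Finset.univ) =>
      tendstoInMeasure_iff_dist.1 (hX k) δ hδ
    simpa using this
  refine tendsto_of_tendsto_of_tendsto_of_le_of_le tendsto_const_nhds hsum
    (fun _ => zero_le) fun n => ?_
  refine (measure_mono fun ω hω => ?_).trans (measure_iUnion_fintype_le P fun k =>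
    {ω | δ ≤ dist (X n k ω) (a k)})
  by_contra hnot
  simp only [Set.mem_iUnion, Set.mem_ofPred_eq, not_exists, not_le] at hnot hω
  exact absurd (hδε ((dist_pi_lt_iff hδ).2 hnot)) (not_lt.2 hω)

/-- Weak law of large numbers for a triangular array of functions of an i.i.d. sequence. -/
theorem tendstoInMeasure_average {Ω S : Type*} [MeasurableSpace Ω] [MeasurableSpace S]
    {P : Measure Ω} [IsProbabilityMeasure P] {Z : ℕ → Ω → S} {Y : Ω → S}
    (hindep : iIndepFun Z P) (hident : ∀ i, IdentDistrib (Z i) Y P P)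
    {g : ℕ → S → ℝ} (hg : ∀ n, Measurable (g n)) {a : ℝ}
    (hL2 : ∀ᶠ n in atTop, MemLp (g n ∘ Y) 2 P)
    (hmean : Tendsto (fun n => ∫ ω, g n (Y ω) ∂P) atTop (𝓝 a))
    (hsq : Tendsto (fun n : ℕ => (n : ℝ)⁻¹ * ∫ ω, g n (Y ω) ^ 2 ∂P) atTop (𝓝 0)) :
    TendstoInMeasure P (fun (n : ℕ) ω => (n : ℝ)⁻¹ * ∑ i ∈ Finset.range n, g n (Z i ω)) atTop
      fun _ => a := by
  rw [tendstoInMeasure_iff_dist]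
  intro ε hε
  -- One half of `ε` absorbs the bias of the mean; the other half enters Chebyshev, with the
  -- variance bounded by the second moment divided by `n`.
  have hlim : Tendsto (fun n : ℕ => ENNReal.ofReal
      (((n : ℝ)⁻¹ * ∫ ω, g n (Y ω) ^ 2 ∂P) / (ε / 2) ^ 2)) atTop (𝓝 0) := by
    have := ENNReal.tendsto_ofReal (hsq.div_const ((ε / 2) ^ 2))
    simpa using this
  refine tendsto_of_tendsto_of_tendsto_of_le_of_le' tendsto_const_nhds hlim
    (Eventually.of_forall fun _ => zero_le) ?_
  filter_upwards [hL2, Metric.tendsto_nhds.1 hmean (ε / 2) (half_pos hε), eventually_gt_atTop 0]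
    with n hn hmn hn0
  have hn0' : (0 : ℝ) < n := Nat.cast_pos.2 hn0
  have hid : ∀ i, IdentDistrib (g n ∘ Z i) (g n ∘ Y) P P := fun i => (hident i).comp (hg n)
  have hmem : ∀ i, MemLp (g n ∘ Z i) 2 P := fun i => (hid i).memLp_iff.2 hn
  set A : Ω → ℝ := fun ω => (n : ℝ)⁻¹ * (∑ i ∈ Finset.range n, g n ∘ Z i) ω with hA
  have hAmem : MemLp A 2 P := (memLp_finsetSum' _ fun i _ => hmem i).const_mul _
  have hAmean : ∫ ω, A ω ∂P = ∫ ω, g n (Y ω) ∂P := by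
    simp only [hA, Finset.sum_apply]
    rw [integral_const_mul, integral_finsetSum _ fun i _ => (hmem i).integrable (by norm_num)]
    have : ∀ i, ∫ ω, (g n ∘ Z i) ω ∂P = ∫ ω, g n (Y ω) ∂P := fun i => (hid i).integral_eq
    simp_rw [this]
    simp only [Finset.sum_const, Finset.card_range, nsmul_eq_mul]
    field_simp
  have hAvar : variance A P ≤ (n : ℝ)⁻¹ * ∫ ω, g n (Y ω) ^ 2 ∂P := by
    rw [hA, variance_const_mul, IndepFun.variance_sum (fun i _ => hmem i)
      fun i _ j _ hij => (hindep.indepFun hij).comp (hg n) (hg n)]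
    simp_rw [(hid _).variance_eq]
    simp only [Finset.sum_const, Finset.card_range, nsmul_eq_mul]
    have h1 : variance (g n ∘ Y) P ≤ ∫ ω, g n (Y ω) ^ 2 ∂P :=
      variance_le_expectation_sq hn.aestronglyMeasurable
    calc ((n : ℝ)⁻¹) ^ 2 * (n * variance (g n ∘ Y) P)
        = (n : ℝ)⁻¹ * variance (g n ∘ Y) P := by field_simp
      _ ≤ _ := by gcongr
  calc P {ω | ε ≤ dist ((n : ℝ)⁻¹ * ∑ i ∈ Finset.range n, g n (Z i ω)) a}
      ≤ P {ω | ε / 2 ≤ |A ω - ∫ ω, A ω ∂P|} := by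
        refine measure_mono fun ω hω => ?_
        simp only [Set.mem_ofPred_eq] at hω ⊢
        have h1 := dist_triangle (A ω) (∫ ω, g n (Y ω) ∂P) a
        have h2 : A ω = (n : ℝ)⁻¹ * ∑ i ∈ Finset.range n, g n (Z i ω) := by simp [hA]
        rw [hAmean, ← Real.dist_eq]
        rw [h2] at h1 ⊢
        linarith
    _ ≤ ENNReal.ofReal (variance A P / (ε / 2) ^ 2) :=
        meas_ge_le_variance_div_sq hAmem (half_pos hε)
    _ ≤ _ := by
        refine ENNReal.ofReal_le_ofReal ?_
        gcongr

theorem IsBandwidth.tendsto_nhdsGT {d : ℕ} {h : ℕ → ℝ} (hh : IsBandwidth d h) :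
    Tendsto h atTop (𝓝[>] 0) :=
  tendsto_nhdsWithin_iff.2 ⟨hh.tendsto_zero, Eventually.of_forall hh.pos⟩

theorem exists_isBandwidth (d : ℕ) : ∃ h, IsBandwidth d h := by
  have hd : (0 : ℝ) < (d : ℝ) + 1 := by positivity
  -- With this exponent `h_n^(d/2)` is at least `(n + 1)^(-1/2)`, because `d / (d + 1) ≤ 1`. Hence
  -- `n h_n^(d/2) ≥ √(n + 1) - 1`, and `d = 0` needs no separate treatment.
  refine ⟨fun n => ((n : ℝ) + 1) ^ (-(1 / (d + 1) : ℝ)), fun n => by positivity, ?_, ?_⟩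
  · exact (tendsto_rpow_neg_atTop (by positivity)).comp
      (tendsto_atTop_add_const_right _ _ tendsto_natCast_atTop_atTop)
  · have hlim : Tendsto (fun n : ℕ => ((n : ℝ) + 1) ^ (1 / 2 : ℝ) - 1) atTop atTop :=
      tendsto_atTop_add_const_right _ (-1) ((tendsto_rpow_atTop (by norm_num)).comp
        (tendsto_atTop_add_const_right _ (1 : ℝ) tendsto_natCast_atTop_atTop))
    refine tendsto_atTop_mono (fun n => ?_) hlim
    have hn : (1 : ℝ) ≤ (n : ℝ) + 1 := by
      have : (0 : ℝ) ≤ n := n.cast_nonneg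
      linarith
    rw [← Real.rpow_mul (by positivity)]
    have he : -(1 / 2 : ℝ) ≤ -(1 / (d + 1)) * (d / 2) := by
      have : (d : ℝ) / (d + 1) ≤ 1 := by rw [div_le_one hd]; linarith
      have e : -(1 / (d + 1) : ℝ) * (d / 2) = -(d / (d + 1) / 2) := by ring
      rw [e]
      linarith
    have h1 := Real.rpow_le_rpow_of_exponent_le hn he
    have h2 : ((n : ℝ) + 1) ^ (1 / 2 : ℝ) = ((n : ℝ) + 1) * ((n : ℝ) + 1) ^ (-(1 / 2 : ℝ)) := by
      rw [← Real.rpow_one_add' (by positivity) (by norm_num)]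
      norm_num
    have h3 : ((n : ℝ) + 1) ^ (-(1 / 2 : ℝ)) ≤ 1 :=
      Real.rpow_le_one_of_one_le_of_nonpos hn (by norm_num)
    have h4 := mul_le_mul_of_nonneg_left h1 (n.cast_nonneg : (0 : ℝ) ≤ n)
    linarith

/-- Convergence in probability of weighted averages of the normalized Dirichlet kernel, at
Lebesgue points of the weighted density `ρ`. -/
theorem tendstoInMeasure_dirichletKernel {d : ℕ} {Ω κ : Type*} [MeasurableSpace Ω]
    [MeasurableSpace κ] {P : Measure Ω} [IsProbabilityMeasure P]
    {Z : ℕ → Ω → Simplex d × κ} {Y : Ω → Simplex d × κ} (hY : Measurable Y)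
    (hindep : iIndepFun Z P) (hident : ∀ i, IdentDistrib (Z i) Y P P)
    {w : κ → ℝ} (hw : Measurable w) (hw0 : ∀ k, 0 ≤ w k) (hw1 : ∀ k, w k ≤ 1)
    {ρ : Simplex d → ℝ} (hρ : Measurable ρ) {a B : ℝ}
    (hB : ∀ᵐ t ∂simplexVolume d, |ρ t| ≤ B)
    (hlaw : ∀ φ : Simplex d → ℝ, Continuous φ →
      ∫ ω, φ (Y ω).1 * w (Y ω).2 ∂P = ∫ t, φ t * ρ t ∂simplexVolume d)
    {s : Simplex d} (hs : s ∈ simplexInterior d) (ha : IsLebesguePoint ρ s a)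
    {h : ℕ → ℝ} (hh : IsBandwidth d h) :
    TendstoInMeasure P (fun (n : ℕ) ω => (n : ℝ)⁻¹ * ∑ i ∈ Finset.range n,
      dirichletKernel (h n) s (Z i ω).1 / (∫ t, dirichletKernel (h n) s t ∂simplexVolume d) *
        w (Z i ω).2) atTop fun _ => a := by
  obtain ⟨C, hC, hker⟩ := exists_dirichletKernel_le_integral_mul hs
  set I : ℕ → ℝ := fun n => ∫ t, dirichletKernel (h n) s t ∂simplexVolume d with hI
  have hkc := fun n => continuous_dirichletKernel (hh.pos n) hs
  set g : ℕ → Simplex d × κ → ℝ := fun n z => dirichletKernel (h n) s z.1 / I n * w z.2 with hgdef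
  have hg : ∀ n, Measurable (g n) := fun n =>
    (((hkc n).measurable.comp measurable_fst).div_const _).mul (hw.comp measurable_snd)
  have hbound : ∀ᶠ n in atTop, ∀ z, 0 ≤ g n z ∧ g n z ≤ C * (√(h n) ^ d)⁻¹ := by
    filter_upwards [hh.tendsto_nhdsGT.eventually hker] with n ⟨hIn, hkn⟩ z
    have hpos := hh.pos n
    have hq : 0 < √(h n) := Real.sqrt_pos.2 hpos
    have h0 : 0 ≤ dirichletKernel (h n) s z.1 / I n :=
      div_nonneg (dirichletKernel_pos hpos hs _).le hIn.le
    refine ⟨mul_nonneg h0 (hw0 _), (mul_le_of_le_one_right h0 (hw1 _)).trans ?_⟩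
    rw [div_le_iff₀ hIn, mul_comm]
    refine (hkn z.1).trans ?_
    refine mul_le_mul_of_nonneg_left ?_ hIn.le
    refine mul_le_of_le_one_right (by positivity) ?_
    refine Real.rpow_le_one_of_one_le_of_nonpos ?_ ?_
    · have : 0 ≤ ‖simplexChart d z.1 - simplexChart d s‖ / √(h n) := by positivity
      linarith
    · have : (0 : ℝ) ≤ d := Nat.cast_nonneg d
      linarith
  have hmean : Tendsto (fun n => ∫ ω, g n (Y ω) ∂P) atTop (𝓝 a) := by
    have h1 := (ha.tendsto_dirichletKernel hs hρ hB).comp hh.tendsto_nhdsGT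
    refine h1.congr fun n => ?_
    rw [hgdef]
    simp only
    rw [hlaw (fun t => dirichletKernel (h n) s t / I n) ((hkc n).div_const _),
      Function.comp_apply, ← integral_div]
    congr 1
    funext t
    ring
  have hmeas : ∀ n, AEStronglyMeasurable (fun ω => g n (Y ω)) P := fun n =>
    ((hg n).comp hY).aestronglyMeasurable
  have hmem : ∀ᶠ n in atTop, MemLp (g n ∘ Y) 2 P := by
    filter_upwards [hbound] with n hn
    refine MemLp.of_bound (hmeas n) (C * (√(h n) ^ d)⁻¹) (Eventually.of_forall fun ω => ?_)
    rw [Function.comp_apply, Real.norm_of_nonneg (hn _).1]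
    exact (hn _).2
  refine tendstoInMeasure_average hindep hident hg hmem hmean ?_
  -- As `0 ≤ g ≤ C h^(-d/2)`, also `g² ≤ C h^(-d/2) g`, so the second moment over `n` is controlled
  -- by the convergent mean divided by `n h^(d/2)`. This is where the growth condition on the
  -- bandwidth enters.
  have hup : Tendsto (fun n : ℕ => C * ((n : ℝ) * h n ^ ((d : ℝ) / 2))⁻¹ *
      ∫ ω, g n (Y ω) ∂P) atTop (𝓝 0) := by
    simpa using (hh.tendsto_mass.inv_tendsto_atTop.const_mul C).mul hmean
  refine tendsto_of_tendsto_of_tendsto_of_le_of_le' tendsto_const_nhds hup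
    (Eventually.of_forall fun n => mul_nonneg (by positivity)
      (integral_nonneg fun ω => sq_nonneg _)) ?_
  filter_upwards [hbound, hmem] with n hn hL2
  have hpow : h n ^ ((d : ℝ) / 2) = √(h n) ^ d := by
    rw [Real.sqrt_eq_rpow, ← Real.rpow_natCast, ← Real.rpow_mul (hh.pos n).le]
    congr 1
    ring
  have hsq : ∫ ω, g n (Y ω) ^ 2 ∂P ≤ C * (√(h n) ^ d)⁻¹ * ∫ ω, g n (Y ω) ∂P := by
    rw [← integral_const_mul]
    refine integral_mono hL2.integrable_sq
      ((hL2.integrable (by norm_num)).const_mul _) fun ω => ?_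
    simp only
    rw [sq]
    exact mul_le_mul_of_nonneg_right (hn _).2 (hn _).1
  calc (n : ℝ)⁻¹ * ∫ ω, g n (Y ω) ^ 2 ∂P
      ≤ (n : ℝ)⁻¹ * (C * (√(h n) ^ d)⁻¹ * ∫ ω, g n (Y ω) ∂P) := by gcongr
    _ = _ := by rw [hpow, mul_inv]; ring

/-! ### Joint density and conditional expectation -/

theorem measurable_uncurry_fin {d : ℕ} {q : Simplex d → Fin (d + 1) → ℝ}
    (hq : ∀ k, Measurable fun s => q s k) :
    Measurable fun z : Simplex d × Fin (d + 1) => q z.1 z.2 :=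
  measurable_from_prod_countable_left hq

/-- The expectation of a function of (score, label) in terms of the joint density. -/
theorem integral_eq_integral_sum_smul {d : ℕ} {Ω E : Type*} [MeasurableSpace Ω]
    [NormedAddCommGroup E] [NormedSpace ℝ E] [CompleteSpace E] {P : Measure Ω}
    {Y : Ω → Simplex d × Fin (d + 1)} (hY : Measurable Y) {q : Simplex d → Fin (d + 1) → ℝ}
    (hq_meas : ∀ k, Measurable fun s => q s k) (hq_nonneg : ∀ s k, 0 ≤ q s k)
    (hq : P.map Y = ((simplexVolume d).prod Measure.count).withDensity
      fun z => ENNReal.ofReal (q z.1 z.2))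
    {G : Simplex d × Fin (d + 1) → E} (hG : StronglyMeasurable G)
    (hint : Integrable (fun ω => G (Y ω)) P) :
    ∫ ω, G (Y ω) ∂P = ∫ t, ∑ k, q t k • G (t, k) ∂simplexVolume d := by
  have hqm := (measurable_uncurry_fin hq_meas).ennreal_ofReal
  have hlt : ∀ᵐ z ∂(simplexVolume d).prod (Measure.count (α := Fin (d + 1))),
      ENNReal.ofReal (q z.1 z.2) < ⊤ := Eventually.of_forall fun z => ENNReal.ofReal_lt_top
  have h1 : Integrable G (P.map Y) :=
    (integrable_map_measure hG.aestronglyMeasurable hY.aemeasurable).2 hint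
  rw [← integral_map hY.aemeasurable hG.aestronglyMeasurable, hq,
    integral_withDensity_eq_integral_toReal_smul hqm hlt, integral_prod]
  · refine integral_congr_ae (Eventually.of_forall fun t => ?_)
    simp only [integral_count, ENNReal.toReal_ofReal (hq_nonneg _ _)]
  · rw [hq] at h1
    exact (integrable_withDensity_iff_integrable_smul' hqm hlt).1 h1

/-- The score density is the sum over the labels of the joint density. -/
theorem ae_eq_sum_joint_density {d : ℕ} {Ω : Type*} [MeasurableSpace Ω] {P : Measure Ω}
    [IsProbabilityMeasure P] {Y : Ω → Simplex d × Fin (d + 1)} (hY : Measurable Y)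
    {p : Simplex d → ℝ} (hp_meas : Measurable p) (hp_nonneg : ∀ s, 0 ≤ p s)
    (hp : P.map (fun ω => (Y ω).1) =
      (simplexVolume d).withDensity fun s => ENNReal.ofReal (p s))
    {q : Simplex d → Fin (d + 1) → ℝ}
    (hq_meas : ∀ k, Measurable fun s => q s k) (hq_nonneg : ∀ s k, 0 ≤ q s k)
    (hq : P.map Y = ((simplexVolume d).prod Measure.count).withDensity
      fun z => ENNReal.ofReal (q z.1 z.2)) :
    ∀ᵐ t ∂simplexVolume d, p t = ∑ k, q t k := by
  have hqm := (measurable_uncurry_fin hq_meas).ennreal_ofReal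
  have hsm : Measurable fun t => ∑ k, ENNReal.ofReal (q t k) :=
    Finset.measurable_sum _ fun k _ => (hq_meas k).ennreal_ofReal
  have heq : (simplexVolume d).withDensity (fun s => ENNReal.ofReal (p s))
      = (simplexVolume d).withDensity fun t => ∑ k, ENNReal.ofReal (q t k) := by
    rw [← hp]
    have hmap : P.map (fun ω => (Y ω).1) = (P.map Y).map Prod.fst :=
      (Measure.map_map measurable_fst hY).symm
    rw [hmap, hq]
    ext A hA
    rw [Measure.map_apply measurable_fst hA, withDensity_apply _ (measurable_fst hA),
      withDensity_apply _ hA, ← Set.prod_univ, ← Measure.prod_restrict,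
      lintegral_prod _ hqm.aemeasurable]
    simp [lintegral_count]
  -- Almost everywhere uniqueness of a density is invoked with finite total mass, here that of a
  -- probability law.
  have hfin : ∫⁻ t, ENNReal.ofReal (p t) ∂simplexVolume d ≠ ⊤ := by
    have h1 := congrArg (fun ν => ν Set.univ) hp
    simp only [withDensity_apply _ MeasurableSet.univ, Measure.restrict_univ] at h1
    rw [← h1]
    exact measure_ne_top _ _
  have hae := (withDensity_eq_iff hp_meas.ennreal_ofReal.aemeasurable hsm.aemeasurable hfin).1 heq
  filter_upwards [hae] with t ht
  rw [← ENNReal.ofReal_sum_of_nonneg fun k _ => hq_nonneg t k] at ht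
  exact (ENNReal.ofReal_eq_ofReal_iff (hp_nonneg t)
    (Finset.sum_nonneg fun k _ => hq_nonneg t k)).1 ht

/-- The simplex has finite diameter, so a Lipschitz function varies by a bounded amount from any
reference point. Only an upper bound is needed, as densities are nonnegative. -/
theorem exists_forall_le_of_lipschitzOnWith {d : ℕ} {p : Simplex d → ℝ}
    (hp_lip : ∃ L, LipschitzOnWith L p (simplexInterior d)) :
    ∃ B, ∀ t ∈ simplexInterior d, p t ≤ B := by
  obtain ⟨L, hL⟩ := hp_lip
  rcases (simplexInterior d).eq_empty_or_nonempty with h | ⟨s, hs⟩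
  · exact ⟨0, fun t ht => by simp [h] at ht⟩
  · refine ⟨p s + L * Metric.diam (Set.univ : Set (Simplex d)), fun t ht => ?_⟩
    have h1 := (le_abs_self _).trans (hL.dist_le_mul t ht s hs)
    have h2 := Metric.dist_le_diam_of_mem (isCompact_univ (X := Simplex d)).isBounded
      (Set.mem_univ t) (Set.mem_univ s)
    have h3 : (L : ℝ) * dist t s ≤ L * Metric.diam (Set.univ : Set (Simplex d)) := by gcongr
    linarith

theorem simplexInterior_mem_nhds {d : ℕ} {s : Simplex d} (hs : s ∈ simplexInterior d) :
    simplexInterior d ∈ 𝓝 s := by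
  have : simplexInterior d = ⋂ k, {s : Simplex d | 0 < s.1 k} := by
    ext s
    simp [simplexInterior]
  rw [this]
  refine (isOpen_iInter_of_finite fun k => ?_).mem_nhds (Set.mem_iInter.2 hs)
  exact isOpen_lt continuous_const ((continuous_apply k).comp continuous_subtype_val)

/-- The conditional mean of the label encoding given the score. -/
theorem condExp_eq_conditionalMean {d : ℕ} {Ω E : Type*} [MeasurableSpace Ω]
    [NormedAddCommGroup E] [NormedSpace ℝ E] [CompleteSpace E] [MeasurableSpace E] [BorelSpace E]
    [SecondCountableTopology E] {P : Measure Ω} [IsProbabilityMeasure P]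
    {T : Ω → Simplex d} (hT : Measurable T) {y : Ω → Fin (d + 1)} (hy : Measurable y)
    (c : Fin (d + 1) → E) {p : Simplex d → ℝ} (hp_meas : Measurable p)
    {q : Simplex d → Fin (d + 1) → ℝ}
    (hq_meas : ∀ k, Measurable fun s => q s k) (hq_nonneg : ∀ s k, 0 ≤ q s k)
    (hq : P.map (fun ω => (T ω, y ω)) = ((simplexVolume d).prod Measure.count).withDensity
      fun z => ENNReal.ofReal (q z.1 z.2))
    (hpq : ∀ᵐ t ∂simplexVolume d, p t = ∑ k, q t k)
    (hac : P.map T ≪ simplexVolume d) :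
    P[fun ω => c (y ω) | MeasurableSpace.comap T inferInstance]
      =ᵐ[P] fun ω => conditionalMean c p q (T ω) := by
  have hY : Measurable fun ω => (T ω, y ω) := hT.prodMk hy
  have hrm : Measurable (conditionalMean c p q) :=
    hp_meas.inv.smul (Finset.measurable_sum _ fun k _ => (hq_meas k).smul_const (c k))
  have hqp : ∀ᵐ t ∂simplexVolume d, ∀ k, q t k ≤ p t := by
    filter_upwards [hpq] with t ht k
    rw [ht]
    exact Finset.single_le_sum (fun k _ => hq_nonneg t k) (Finset.mem_univ k)
  have hrbound : ∀ᵐ ω ∂P, ‖conditionalMean c p q (T ω)‖ ≤ ∑ k, ‖c k‖ := by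
    have h1 := ae_of_ae_map hT.aemeasurable (hac.ae_le hqp)
    filter_upwards [h1] with ω hω
    have hp0 : 0 ≤ p (T ω) := (hq_nonneg _ 0).trans (hω 0)
    rw [conditionalMean, norm_smul, norm_inv, Real.norm_of_nonneg hp0, ← div_eq_inv_mul]
    refine div_le_of_le_mul₀ hp0 (by positivity) ?_
    rw [Finset.sum_mul]
    refine norm_sum_le_of_le _ fun k _ => ?_
    rw [norm_smul, Real.norm_of_nonneg (hq_nonneg _ _), mul_comm]
    gcongr
    exact hω k
  have hrint : Integrable (fun ω => conditionalMean c p q (T ω)) P :=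
    Integrable.of_bound (hrm.comp hT).aestronglyMeasurable _ hrbound
  have hcint : Integrable (fun ω => c (y ω)) P := by
    refine Integrable.of_bound ((measurable_of_finite c).comp hy).aestronglyMeasurable
      (∑ k, ‖c k‖) (Eventually.of_forall fun ω => ?_)
    exact Finset.single_le_sum (f := fun k => ‖c k‖) (fun k _ => norm_nonneg _)
      (Finset.mem_univ (y ω))
  refine (ae_eq_condExp_of_forall_setIntegral_eq hT.comap_le hcint
    (fun _ _ _ => hrint.integrableOn) ?_ ?_).symm
  · rintro _ ⟨A, hA, rfl⟩ -
    have hA' : MeasurableSet (T ⁻¹' A) := hT hA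
    have hAf : MeasurableSet (Prod.fst ⁻¹' A : Set (Simplex d × Fin (d + 1))) :=
      measurable_fst hA
    rw [← integral_indicator hA', ← integral_indicator hA']
    have e1 := integral_eq_integral_sum_smul hY hq_meas hq_nonneg hq
      (G := (Prod.fst ⁻¹' A).indicator fun z => conditionalMean c p q z.1)
      ((hrm.comp measurable_fst).stronglyMeasurable.indicator hAf)
      (hrint.indicator hA')
    have e2 := integral_eq_integral_sum_smul hY hq_meas hq_nonneg hq
      (G := (Prod.fst ⁻¹' A).indicator fun z => c z.2)
      (((measurable_of_finite c).comp measurable_snd).stronglyMeasurable.indicator hAf)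
      (hcint.indicator hA')
    refine Eq.trans e1 (Eq.trans ?_ e2.symm)
    refine integral_congr_ae ?_
    filter_upwards [hpq, hqp] with t ht hqt
    by_cases htA : t ∈ A
    · have hmem : ∀ k, (t, k) ∈ (Prod.fst ⁻¹' A : Set (Simplex d × Fin (d + 1))) := fun _ => htA
      simp only [Set.indicator_of_mem (hmem _)]
      rw [← Finset.sum_smul, ← ht, conditionalMean]
      -- Where `p` vanishes the quotient is zero by the convention `0⁻¹ = 0`. The identity survives
      -- there because `0 ≤ q t k ≤ p t` makes all joint densities vanish too.
      by_cases hp0 : p t = 0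
      · have hq0 : ∀ k, q t k = 0 := fun k => le_antisymm (hp0 ▸ hqt k) (hq_nonneg t k)
        simp [hp0, hq0]
      · rw [smul_inv_smul₀ hp0]
    · have hmem : ∀ k, (t, k) ∉ (Prod.fst ⁻¹' A : Set (Simplex d × Fin (d + 1))) := fun _ => htA
      simp only [Set.indicator_of_notMem (hmem _)]
  · exact (hrm.stronglyMeasurable.comp_measurable
      (comap_measurable T)).aestronglyMeasurable

/-! ### Consistency of the kernel ratio -/

/-- Consistency of the kernel ratio at common Lebesgue points of the densities. -/
theorem tendstoInMeasure_kernelRatio {d : ℕ} {Ω E : Type*} [MeasurableSpace Ω]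
    [NormedAddCommGroup E] [NormedSpace ℝ E] {P : Measure Ω} [IsProbabilityMeasure P]
    {Z : ℕ → Ω → Simplex d × Fin (d + 1)} {Y : Ω → Simplex d × Fin (d + 1)} (hY : Measurable Y)
    (hindep : iIndepFun Z P) (hident : ∀ i, IdentDistrib (Z i) Y P P)
    (c : Fin (d + 1) → E)
    {p : Simplex d → ℝ} (hp_meas : Measurable p) (hp_nonneg : ∀ s, 0 ≤ p s)
    (hp : P.map (fun ω => (Y ω).1) =
      (simplexVolume d).withDensity fun s => ENNReal.ofReal (p s))
    {q : Simplex d → Fin (d + 1) → ℝ}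
    (hq_meas : ∀ k, Measurable fun s => q s k) (hq_nonneg : ∀ s k, 0 ≤ q s k)
    (hq : P.map Y = ((simplexVolume d).prod Measure.count).withDensity
      fun z => ENNReal.ofReal (q z.1 z.2))
    {B : ℝ} (hpB : ∀ᵐ t ∂simplexVolume d, p t ≤ B)
    {s : Simplex d} (hs : s ∈ simplexInterior d) (hps : 0 < p s)
    (hpL : IsLebesguePoint p s (p s)) (hqL : ∀ k, IsLebesguePoint (fun t => q t k) s (q s k))
    {h : ℕ → ℝ} (hh : IsBandwidth d h) :
    TendstoInMeasure P (fun n ω => kernelRatio (h n) n (fun i => (Z i ω).1)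
      (fun i => c (Z i ω).2) s) atTop fun _ => conditionalMean c p q s := by
  classical
  have hpq := ae_eq_sum_joint_density hY hp_meas hp_nonneg hp hq_meas hq_nonneg hq
  have hbdd : ∀ φ : Simplex d → ℝ, Continuous φ → ∃ K, ∀ t, ‖φ t‖ ≤ K := fun φ hφ =>
    (isCompact_univ.exists_bound_of_continuousOn hφ.continuousOn).imp fun K hK t =>
      hK t (Set.mem_univ t)
  have hnum : ∀ k, TendstoInMeasure P (fun (n : ℕ) ω => (n : ℝ)⁻¹ * ∑ i ∈ Finset.range n,
      dirichletKernel (h n) s (Z i ω).1 / (∫ t, dirichletKernel (h n) s t ∂simplexVolume d) *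
        (if (Z i ω).2 = k then 1 else 0)) atTop fun _ => q s k := by
    intro k
    have hwm : Measurable fun j : Fin (d + 1) => if j = k then (1 : ℝ) else 0 :=
      measurable_of_finite _
    refine tendstoInMeasure_dirichletKernel (B := B) hY hindep hident
      (w := fun j => if j = k then 1 else 0) hwm (fun j => by split_ifs <;> simp)
      (fun j => by split_ifs <;> simp) (hq_meas k) ?_ ?_ hs (hqL k) hh
    · filter_upwards [hpB, hpq] with t ht htq
      rw [abs_of_nonneg (hq_nonneg t k)]
      refine le_trans ?_ ht
      rw [htq]
      exact Finset.single_le_sum (fun k _ => hq_nonneg t k) (Finset.mem_univ k)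
    · intro φ hφ
      obtain ⟨K, hK⟩ := hbdd φ hφ
      have hGm : Measurable fun z : Simplex d × Fin (d + 1) =>
          φ z.1 * (if z.2 = k then (1 : ℝ) else 0) :=
        (hφ.measurable.comp measurable_fst).mul (hwm.comp measurable_snd)
      rw [integral_eq_integral_sum_smul hY hq_meas hq_nonneg hq hGm.stronglyMeasurable]
      · simp [mul_comm]
      · refine Integrable.of_bound (hGm.comp hY).aestronglyMeasurable K
          (Eventually.of_forall fun ω => ?_)
        refine le_trans ?_ (hK (Y ω).1)
        rw [norm_mul]
        refine mul_le_of_le_one_right (norm_nonneg _) ?_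
        split_ifs <;> simp
  have hden : TendstoInMeasure P (fun (n : ℕ) ω => (n : ℝ)⁻¹ * ∑ i ∈ Finset.range n,
      dirichletKernel (h n) s (Z i ω).1 / (∫ t, dirichletKernel (h n) s t ∂simplexVolume d) *
        1) atTop fun _ => p s := by
    refine tendstoInMeasure_dirichletKernel (B := B) hY hindep hident (w := fun _ => 1)
      measurable_const (fun _ => zero_le_one) (fun _ => le_rfl) hp_meas ?_ ?_ hs hpL hh
    · filter_upwards [hpB] with t ht
      rwa [abs_of_nonneg (hp_nonneg t)]
    · intro φ hφ
      simp only [mul_one]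
      rw [← integral_map (φ := fun ω => (Y ω).1) (f := φ) (measurable_fst.comp hY).aemeasurable
        hφ.aestronglyMeasurable, hp, integral_withDensity_eq_integral_toReal_smul
        hp_meas.ennreal_ofReal (Eventually.of_forall fun _ => ENNReal.ofReal_lt_top)]
      simp [ENNReal.toReal_ofReal (hp_nonneg _), mul_comm]
  -- The index `none` carries the denominator and `some k` the numerator of class `k`, so that one
  -- continuous map `F` of the whole vector yields the limit of the ratio.
  set X : ℕ → Option (Fin (d + 1)) → Ω → ℝ := fun n k ω => (n : ℝ)⁻¹ * ∑ i ∈ Finset.range n,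
      dirichletKernel (h n) s (Z i ω).1 / (∫ t, dirichletKernel (h n) s t ∂simplexVolume d) *
        k.elim 1 (fun k => if (Z i ω).2 = k then 1 else 0) with hX
  set a : Option (Fin (d + 1)) → ℝ := fun k => k.elim (p s) (q s) with ha
  set F : (Option (Fin (d + 1)) → ℝ) → E := fun v => (v none)⁻¹ • ∑ k, v (some k) • c k with hF
  have hFc : ContinuousAt F a := by
    refine ContinuousAt.smul (ContinuousAt.inv₀ (continuous_apply none).continuousAt hps.ne') ?_
    exact Continuous.continuousAt (by fun_prop)
  have hXlim : ∀ k, TendstoInMeasure P (fun n => X n k) atTop fun _ => a k := by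
    rintro (_ | k)
    · exact hden
    · exact hnum k
  refine (TendstoInMeasure.comp_continuousAt hXlim hFc).congr' ?_ EventuallyEq.rfl
  obtain ⟨C, -, hker⟩ := exists_dirichletKernel_le_integral_mul hs
  filter_upwards [hh.tendsto_nhdsGT.eventually hker, eventually_gt_atTop 0] with n ⟨hI, _⟩ hn
  refine Eventually.of_forall fun ω => ?_
  set I := ∫ t, dirichletKernel (h n) s t ∂simplexVolume d
  have hn' : (n : ℝ) ≠ 0 := Nat.cast_ne_zero.2 hn.ne'
  -- The normalization is a common nonzero scalar in numerator and denominator, so it cancels; `n =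
  -- 0` was excluded for this.
  have hscale : ((n : ℝ)⁻¹ * I⁻¹) ≠ 0 := mul_ne_zero (inv_ne_zero hn') (inv_ne_zero hI.ne')
  have hd1 : X n none ω
      = ((n : ℝ)⁻¹ * I⁻¹) * ∑ i ∈ Finset.range n, dirichletKernel (h n) s (Z i ω).1 := by
    simp only [hX, Option.elim, mul_one]
    rw [← Finset.sum_div]
    ring
  have hn1 : ∑ k, X n (some k) ω • c k = ((n : ℝ)⁻¹ * I⁻¹) •
      ∑ i ∈ Finset.range n, dirichletKernel (h n) s (Z i ω).1 • c (Z i ω).2 := by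
    simp only [hX, Option.elim, Finset.mul_sum, Finset.sum_smul, Finset.smul_sum]
    rw [Finset.sum_comm]
    refine Finset.sum_congr rfl fun i _ => ?_
    rw [Finset.sum_eq_single (Z i ω).2 (fun k _ hk => by simp [hk.symm]) (by simp), smul_smul]
    congr 1
    simp only [if_true]
    ring
  simp only [hF, kernelRatio]
  rw [hd1, hn1, mul_inv, smul_smul, mul_right_comm, inv_mul_cancel₀ hscale, one_mul]

theorem proposition1 {d m : ℕ} {Ω X : Type*} [MeasurableSpace Ω] [MeasurableSpace X]
    (P : Measure Ω) [IsProbabilityMeasure P]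
    -- the feature `x`, the class label `y`, the model `f`
    (x : Ω → X) (hx : Measurable x) (y : Ω → Fin (d + 1)) (hy : Measurable y)
    (f : X → Simplex d) (hf : Measurable f)
    -- the encoding of the labels as (real) vectors, e.g. one-hot
    (c : Fin (d + 1) → EuclideanSpace ℝ (Fin m))
    -- an i.i.d. sample from the law of `(x, y)`
    (xs : ℕ → Ω → X) (ys : ℕ → Ω → Fin (d + 1))
    (hindep : iIndepFun (fun (i : ℕ) (ω : Ω) => (xs i ω, ys i ω)) P)
    (hident : ∀ i, IdentDistrib (fun ω => (xs i ω, ys i ω)) (fun ω => (x ω, y ω)) P P)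
    -- `p` is a density of `f(x)`, Lipschitz on the interior of the simplex
    (p : Simplex d → ℝ) (hp_meas : Measurable p) (hp_nonneg : ∀ s, 0 ≤ p s)
    (hp : P.map (fun ω => f (x ω)) =
      (simplexVolume d).withDensity (fun s => ENNReal.ofReal (p s)))
    (hp_lip : ∃ L, LipschitzOnWith L p (simplexInterior d))
    -- `q` is a joint density of `(f(x), y)`
    (q : Simplex d → Fin (d + 1) → ℝ) (hq_meas : ∀ k, Measurable (fun s => q s k))
    (hq_nonneg : ∀ s k, 0 ≤ q s k)
    (hq : P.map (fun ω => (f (x ω), y ω)) =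
      ((simplexVolume d).prod Measure.count).withDensity
        (fun z => ENNReal.ofReal (q z.1 z.2))) :
    -- the target is the conditional expectation of the encoded label given `f(x)`
    (P[fun ω => c (y ω) | MeasurableSpace.comap (fun ω => f (x ω)) inferInstance]
      =ᵐ[P] fun ω => conditionalMean c p q (f (x ω))) ∧
    -- bandwidth sequences exist
    (∃ h, IsBandwidth d h) ∧
    -- consistency at almost every value of `f(x)`
    (∀ᵐ s ∂(P.map (fun ω => f (x ω))), ∀ h, IsBandwidth d h →
      TendstoInMeasure P
        (fun n ω => kernelRatio (h n) n (fun i => f (xs i ω)) (fun i => c (ys i ω)) s)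
        atTop (fun _ => conditionalMean c p q s)) ∧
    -- consistency at each interior point of positive density where `q` is continuous
    (∀ s ∈ simplexInterior d, 0 < p s → (∀ k, ContinuousAt (fun t => q t k) s) →
      ∀ h, IsBandwidth d h →
      TendstoInMeasure P
        (fun n ω => kernelRatio (h n) n (fun i => f (xs i ω)) (fun i => c (ys i ω)) s)
        atTop (fun _ => conditionalMean c p q s)) := by
  have hT : Measurable fun ω => f (x ω) := hf.comp hx
  have hY : Measurable fun ω => (f (x ω), y ω) := hT.prodMk hy
  have hu : Measurable fun z : X × Fin (d + 1) => (f z.1, z.2) :=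
    (hf.comp measurable_fst).prodMk measurable_snd
  have hindepZ : iIndepFun (fun (i : ℕ) ω => (f (xs i ω), ys i ω)) P :=
    hindep.comp (fun _ z => (f z.1, z.2)) fun _ => hu
  have hidentZ : ∀ i, IdentDistrib (fun ω => (f (xs i ω), ys i ω)) (fun ω => (f (x ω), y ω)) P P :=
    fun i => (hident i).comp hu
  have hpq := ae_eq_sum_joint_density hY hp_meas hp_nonneg hp hq_meas hq_nonneg hq
  have hac : P.map (fun ω => f (x ω)) ≪ simplexVolume d :=
    hp ▸ withDensity_absolutelyContinuous _ _
  obtain ⟨B, hB⟩ := exists_forall_le_of_lipschitzOnWith hp_lip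
  have hpB : ∀ᵐ t ∂simplexVolume d, p t ≤ B := (ae_mem_simplexInterior d).mono fun t ht => hB t ht
  have hpcont : ∀ s ∈ simplexInterior d, IsLebesguePoint p s (p s) := fun s hs => by
    obtain ⟨L, hL⟩ := hp_lip
    exact (hL.continuousOn.continuousAt (simplexInterior_mem_nhds hs)).isLebesguePoint hs
  -- Both consistency claims are instances of this statement. Its conditions on `s` do not involve
  -- the bandwidth, so the exceptional null set is the same for all sequences.
  have hmain : ∀ s ∈ simplexInterior d, 0 < p s →
      (∀ k, IsLebesguePoint (fun t => q t k) s (q s k)) → ∀ h, IsBandwidth d h →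
      TendstoInMeasure P
        (fun n ω => kernelRatio (h n) n (fun i => f (xs i ω)) (fun i => c (ys i ω)) s)
        atTop (fun _ => conditionalMean c p q s) := fun s hs hps hqs h hh =>
    tendstoInMeasure_kernelRatio hY hindepZ hidentZ c hp_meas hp_nonneg hp hq_meas hq_nonneg hq
      hpB hs hps (hpcont s hs) hqs hh
  refine ⟨condExp_eq_conditionalMean hT hy c hp_meas hq_meas hq_nonneg hq hpq hac,
    exists_isBandwidth d, ?_, fun s hs hps hqs => hmain s hs hps fun k =>
      (hqs k).isLebesguePoint hs⟩
  have hqint : ∀ k, Integrable (fun t => q t k) (simplexVolume d) := fun k => by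
    refine Integrable.of_bound (hq_meas k).aestronglyMeasurable B ?_
    filter_upwards [hpB, hpq] with t ht htq
    rw [Real.norm_of_nonneg (hq_nonneg t k)]
    refine le_trans ?_ ht
    rw [htq]
    exact Finset.single_le_sum (fun k _ => hq_nonneg t k) (Finset.mem_univ k)
  have hpos : ∀ᵐ s ∂P.map (fun ω => f (x ω)), 0 < p s := by
    rw [hp, ae_withDensity_iff hp_meas.ennreal_ofReal]
    exact Eventually.of_forall fun s hs =>
      ENNReal.ofReal_pos.1 (pos_iff_ne_zero.2 hs)
  filter_upwards [hpos, hac.ae_le (ae_mem_simplexInterior d),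
    hac.ae_le (ae_all_iff.2 fun k => ae_isLebesguePoint (hqint k))] with s hps hs hqs
  exact hmain s hs hps fun k => hqs k hs
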